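/- Let $N\ge 1$, $\mathbb T=\mathbb R/\mathbb Z\simeq[0,1)$, let $\mathcal D$ be the set of dyadic intervals $[k2^{-n},(k+1)2^{-n})\subseteq[0,1)$ and $\mathcal R=\mathcal D^N$ the set of dyadic rectangles $R=R_1\times\cdots\times R_N\subseteq\mathbb T^N$. For $I\in\mathcal D$ put $h_I=|I|^{-1/2}(\chi_{I^+}-\chi_{I^-})$, where $I^+,I^-$ are the right and left halves of $I$, and $h_R(t)=\prod_{i}h_{R_i}(t_i)$. For a (real or complex valued) $f\in L^2(\mathbb T^N)$ put $f_R=\langle f,h_R\rangle$ and $m_Rf=|R|^{-1}\int_Rf$. - $\mathrm{BMO}^d(\mathbb T^N)$ consists of all $f\in L^2(\mathbb T^N)$ with $f=\sum_{R\in\mathcal R}f_Rh_R$ and $$\|f\|_{\mathrm{BMO}^d}^2=\sup_{\Omega}\frac1{|\Omega|}\sum_{R\in\mathcal R,\,R\subseteq\Omega}|f_R|^2<\infty,$$ the supremum being over all nonempty open sets $\Omega\subseteq\mathbb T^N$. - $\mathrm{bmo}^d(\mathbb T^N)$ consists of all $f\in L^2(\mathbb T^N)$ with $\|f\|_*=\sup_{R\in\mathcal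 R}\frac1{|R|}\int_R|f-m_Rf|<\infty$. It contains the constants and is normed by $\|f\|_{\mathrm{bmo}^d}=\left|\int_{\mathbb T^N}f\right|+\|f\|_*$. - For $j\in\mathbb N_0^N$ let $Q_jf=\sum_{k\ge j}\ \sum_{R:\,|R_i|=2^{-k_i}\,\forall i}f_Rh_R$, where $k\in\mathbb N_0^N$ and $k\ge j$ is meant coordinatewise. $\mathrm{LMO}^d(\mathbb T^N)$ consists of all $\phi\in L^2(\mathbb T^N)$ for which there is a constant $C$ with $$\|Q_j\phi\|_{\mathrm{BMO}^d}\le\frac{C}{j_1+\cdots+j_N+N}\qquad\text{for all }j\in\mathbb N_0^N,$$ and $\|\phi\|_{\mathrm{LMO}^d}$ is the infimum of these constants. - For $\phi\in L^2(\mathbb T^N)$ the main dyadic paraproduct is $\Pi_\phi f=\sum_{R\in\mathcal R}h_R\,\phi_R\,m_Rf$. It is called bounded from $\mathrm{bmo}^d(\mathbb T^N)$ to $\mathrm{BMO}^d(\mathbb T^N)$ if there is a constant $C$ such that for every $f\in\mathrm{bmo}^d(\mathbb T^N)$ this series converges unconditionally in $L^2(\mathbb T^N)$, its sum is in $\mathrm{BMO}^d(\mathbb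 T^N)$ and $\|\Pi_\phi f\|_{\mathrm{BMO}^d}\le C\|f\|_{\mathrm{bmo}^d}$; $\|\Pi_\phi\|_{\mathrm{bmo}^d\to\mathrm{BMO}^d}$ is the infimum of these constants. **Theorem.** Let $\phi\in L^2(\mathbb T^N)$. Then $\Pi_\phi$ is bounded from $\mathrm{bmo}^d(\mathbb T^N)$ to $\mathrm{BMO}^d(\mathbb T^N)$ if and only if $\phi\in\mathrm{LMO}^d(\mathbb T^N)$. Moreover $\|\Pi_\phi\|_{\mathrm{bmo}^d\to\mathrm{BMO}^d}\approx\|\phi\|_{\mathrm{LMO}^d}$: there are constants $c,C>0$, not depending on $\phi$ (only on $N$), with $$c\,\|\phi\|_{\mathrm{LMO}^d}\le\|\Pi_\phi\|_{\mathrm{bmo}^d\to\mathrm{BMO}^d}\le C\,\|\phi\|_{\mathrm{LMO}^d}.$$ -/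

import Mathlib

open MeasureTheory
open scoped ENNReal NNReal

namespace DyadicTorus

noncomputable section

/-- The dyadic arc `[k / 2 ^ n, (k + 1) / 2 ^ n)` of the circle `𝕋 = ℝ / ℤ ≃ [0, 1)`
(used for `k < 2 ^ n`). -/
def arc (n k : ℕ) : Set UnitAddCircle :=
  {x | (AddCircle.equivIco (1 : ℝ) 0 x : ℝ) ∈
    Set.Ico ((k : ℝ) / 2 ^ n) (((k : ℝ) + 1) / 2 ^ n)}

/-- The Haar function `|I|^{-1/2} (χ_{I⁺} - χ_{I⁻})` of the dyadic arc `I = arc n k`, where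
`I⁺ = arc (n + 1) (2 k + 1)` is the right half of `I` and `I⁻ = arc (n + 1) (2 k)` the left half. -/
def haar₁ (n k : ℕ) (x : UnitAddCircle) : ℝ :=
  √((2 : ℝ) ^ n) * ((arc (n + 1) (2 * k + 1)).indicator 1 x - (arc (n + 1) (2 * k)).indicator 1 x)

/-- Positions of the dyadic rectangles of generation `j ∈ ℕ₀^N`. -/
abbrev Pos {N : ℕ} (j : Fin N → ℕ) : Type := (i : Fin N) → Fin (2 ^ j i)

/-- A dyadic rectangle `R = R₁ × ⋯ × R_N` of `𝕋^N`: its generation `(j₁, …, j_N)`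
(so that `|R_i| = 2 ^ (-j_i)`) and its position. -/
abbrev Rect (N : ℕ) : Type := (j : Fin N → ℕ) × Pos j

/-- The subset of `𝕋^N` given by a dyadic rectangle. -/
def Rect.toSet {N : ℕ} (R : Rect N) : Set (UnitAddTorus (Fin N)) :=
  {x | ∀ i, x i ∈ arc (R.1 i) (R.2 i)}

/-- The product Haar function `h_R(t) = h_{R₁}(t₁) ⋯ h_{R_N}(t_N)`. -/
def haarFun {N : ℕ} (R : Rect N) (x : UnitAddTorus (Fin N)) : ℝ :=
  ∏ i, haar₁ (R.1 i) (R.2 i) (x i)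

theorem measurableSet_arc (n k : ℕ) : MeasurableSet (arc n k) := by
  have h : Measurable fun x : UnitAddCircle => (AddCircle.equivIco (1 : ℝ) 0 x : ℝ) :=
    measurable_subtype_coe.comp (AddCircle.measurableEquivIco (1 : ℝ) 0).measurable
  exact h measurableSet_Ico

theorem measurable_haar₁ (n k : ℕ) : Measurable (haar₁ n k) :=
  ((measurable_one.indicator (measurableSet_arc _ _)).sub
    (measurable_one.indicator (measurableSet_arc _ _))).const_mul _

theorem abs_haar₁_le (n k : ℕ) (x : UnitAddCircle) : |haar₁ n k x| ≤ √((2 : ℝ) ^ n) := by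
  unfold haar₁
  rw [abs_mul, abs_of_nonneg (Real.sqrt_nonneg _)]
  refine mul_le_of_le_one_right (Real.sqrt_nonneg _) ?_
  by_cases h₁ : x ∈ arc (n + 1) (2 * k + 1) <;> by_cases h₂ : x ∈ arc (n + 1) (2 * k) <;>
    simp [h₁, h₂]

theorem memLp_haarFun (𝕜 : Type*) [RCLike 𝕜] {N : ℕ} (R : Rect N) :
    MemLp (fun x => (haarFun R x : 𝕜)) 2 (volume : Measure (UnitAddTorus (Fin N))) := by
  have hm : Measurable (haarFun R) :=
    Finset.measurable_prod _ fun i _ => (measurable_haar₁ _ _).comp (measurable_pi_apply i)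
  refine MemLp.of_bound (RCLike.measurable_ofReal.comp hm).aestronglyMeasurable
    (∏ i, √((2 : ℝ) ^ R.1 i)) (Filter.Eventually.of_forall fun x => ?_)
  rw [RCLike.norm_ofReal, haarFun, Finset.abs_prod]
  exact Finset.prod_le_prod (fun _ _ => abs_nonneg _) fun _ _ => abs_haar₁_le _ _ _

/-- The space `L²(𝕋^N)` of (real or complex valued) square integrable functions. -/
abbrev L2 (𝕜 : Type*) [RCLike 𝕜] (N : ℕ) : Type _ :=
  Lp 𝕜 2 (volume : Measure (UnitAddTorus (Fin N)))

variable {𝕜 : Type*} [RCLike 𝕜] {N : ℕ}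

/-- The Haar function `h_R` as an element of `L²(𝕋^N)`. -/
def haar (𝕜 : Type*) [RCLike 𝕜] {N : ℕ} (R : Rect N) : L2 𝕜 N :=
  (memLp_haarFun 𝕜 R).toLp _

/-- The Haar coefficient `f_R = ⟨f, h_R⟩ = ∫ f h_R`. -/
def coeff (f : L2 𝕜 N) (R : Rect N) : 𝕜 := inner 𝕜 (haar 𝕜 R) f

/-- The mean `m_R f = |R|⁻¹ ∫_R f`. -/
def mean (f : L2 𝕜 N) (R : Rect N) : 𝕜 := ⨍ x in R.toSet, f x

/-- The subspace `L²₀(𝕋^N)` of functions with `f = ∑_R f_R h_R`. -/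
def MemL20 (f : L2 𝕜 N) : Prop := HasSum (fun R : Rect N => coeff f R • haar 𝕜 R) f

/-- The norm of dyadic product BMO:
`‖f‖² = sup_Ω |Ω|⁻¹ ∑_{R ⊆ Ω} |f_R|²`, the supremum over all open sets `Ω ⊆ 𝕋^N`. -/
def productBMONorm (f : L2 𝕜 N) : ℝ≥0∞ :=
  (⨆ (Ω : Set (UnitAddTorus (Fin N))) (_ : IsOpen Ω) (_ : Ω.Nonempty),
    (volume Ω)⁻¹ * ∑' R : {R : Rect N // R.toSet ⊆ Ω}, ‖coeff f R‖ₑ ^ 2) ^ (1 / 2 : ℝ)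

/-- Membership in dyadic product `BMO^d(𝕋^N)`. -/
def MemProductBMO (f : L2 𝕜 N) : Prop := MemL20 f ∧ productBMONorm f < ∞

/-- The mean oscillation seminorm of dyadic little bmo:
`sup_R |R|⁻¹ ∫_R |f - m_R f|`, the supremum over all dyadic rectangles. -/
def littleBmoSeminorm (f : L2 𝕜 N) : ℝ≥0∞ :=
  ⨆ R : Rect N, (volume R.toSet)⁻¹ * ∫⁻ x in R.toSet, ‖f x - mean f R‖ₑ

/-- Membership in dyadic little `bmo^d(𝕋^N)`. -/
def MemLittleBmo (f : L2 𝕜 N) : Prop := littleBmoSeminorm f < ∞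

/-- The norm of dyadic little `bmo^d(𝕋^N)`. This space contains the constants, on which the
oscillation seminorm vanishes, so the modulus of the mean over `𝕋^N` is added. -/
def littleBmoNorm (f : L2 𝕜 N) : ℝ≥0∞ := ‖∫ x, f x‖ₑ + littleBmoSeminorm f

/-- The martingale difference `Δ_j f = ∑_{R of generation j} f_R h_R`. -/
def martingaleDiff (j : Fin N → ℕ) (f : L2 𝕜 N) : L2 𝕜 N :=
  ∑ p : Pos j, coeff f ⟨j, p⟩ • haar 𝕜 ⟨j, p⟩

/-- The operator `Q_j f = ∑_{k ≥ j} Δ_k f`, with `k ≥ j` coordinatewise; the series converges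
unconditionally in `L²(𝕋^N)`. -/
def tailProj (j : Fin N → ℕ) (f : L2 𝕜 N) : L2 𝕜 N :=
  ∑' k : {k : Fin N → ℕ // j ≤ k}, martingaleDiff k.1 f

/-- `C` is a constant in the definition of `LMO^d(𝕋^N)`:
`‖Q_j φ‖_{BMO^d} ≤ C / (j₁ + ⋯ + j_N + N)` for all `j`. -/
def IsLMOBound (φ : L2 𝕜 N) (C : ℝ≥0) : Prop :=
  ∀ j : Fin N → ℕ,
    productBMONorm (tailProj j φ) ≤ (C : ℝ≥0∞) / ((∑ i, (j i : ℝ≥0∞)) + (N : ℝ≥0∞))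

/-- Membership in `LMO^d(𝕋^N)`. -/
def MemLMO (φ : L2 𝕜 N) : Prop := ∃ C : ℝ≥0, IsLMOBound φ C

/-- The norm of `LMO^d(𝕋^N)`: the infimum of the admissible constants (`∞` if there is none). -/
def lmoNorm (φ : L2 𝕜 N) : ℝ≥0∞ := ⨅ (C : ℝ≥0) (_ : IsLMOBound φ C), (C : ℝ≥0∞)

/-- The terms `h_R φ_R m_R f` of the main paraproduct. -/
def paraproductTerm (φ f : L2 𝕜 N) (R : Rect N) : L2 𝕜 N :=
  (coeff φ R * mean f R) • haar 𝕜 R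

/-- The main paraproduct `Π_φ f = ∑_R h_R φ_R m_R f`. -/
def paraproduct (φ f : L2 𝕜 N) : L2 𝕜 N := ∑' R : Rect N, paraproductTerm φ f R

/-- `C` bounds `Π_φ` as an operator `bmo^d(𝕋^N) → BMO^d(𝕋^N)`: for every `f ∈ bmo^d(𝕋^N)` the
series of `Π_φ f` converges (unconditionally, in `L²(𝕋^N)`), its sum is in `BMO^d(𝕋^N)`, and
`‖Π_φ f‖_{BMO^d} ≤ C ‖f‖_{bmo^d}`. -/
def IsParaproductBound (φ : L2 𝕜 N) (C : ℝ≥0) : Prop :=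
  ∀ f : L2 𝕜 N, MemLittleBmo f →
    Summable (paraproductTerm φ f) ∧ MemProductBMO (paraproduct φ f) ∧
      productBMONorm (paraproduct φ f) ≤ (C : ℝ≥0∞) * littleBmoNorm f

/-- `Π_φ : bmo^d(𝕋^N) → BMO^d(𝕋^N)` is (well defined and) bounded. -/
def ParaproductBounded (φ : L2 𝕜 N) : Prop := ∃ C : ℝ≥0, IsParaproductBound φ C

/-- The operator norm of `Π_φ : bmo^d(𝕋^N) → BMO^d(𝕋^N)` (`∞` if it is not bounded). -/
def paraproductNorm (φ : L2 𝕜 N) : ℝ≥0∞ :=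
  ⨅ (C : ℝ≥0) (_ : IsParaproductBound φ C), (C : ℝ≥0∞)

end

end DyadicTorus

/-!
Both directions compare the two norms through the energies `∑_{R ⊆ E} |f_R|²`. By outer regularity
the open sets in the norm of product BMO may be replaced by arbitrary sets `E`
(`productBMONorm_le_iff`), and by orthonormality of the Haar system the coefficients of `Π_φ f` are
`φ_R m_R f`.

*Bounded paraproducts have symbols in LMO.* For a rectangle `R` of generation `j` the function
`logSum 𝕜 R` is the sum over the coordinates of truncated logarithms. It equals `j₁ + ⋯ + j_N + N`
on `R`, and its norm in little bmo is at most `4 N`. Testing `Π_φ` on it bounds the energy of `φ` on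
the subsets of `R`, and summing over the disjoint rectangles of generation `j` bounds the norm of
`Q_j φ`.

*Symbols in LMO have bounded paraproducts.* Let `‖f‖ ≤ K` in little bmo. The means satisfy
`‖m_R f‖ / K + 1 ≤ 2 (j₁ + ⋯ + j_N + N)` by telescoping (`relMean_le`). The rectangles `R ⊆ E` are
sorted into levels by the integer `l` with `2 ^ l ≤ ‖m_R f‖ / K + 1 < 2 ^ (l + 1)`. A rectangle of
level `l` has a side of generation at least of order `2 ^ l / N`, so the decay of the tails of `φ`
bounds the energy of `φ` on the rectangles of this level by a multiple of `4 ^ (-l) |U_l|`, where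
`U_l` is any set containing them (`IsLMOBound.energy_le`). This cancels the factor `‖m_R f‖²`, and
what remains is to find sets `U_l` with `∑ |U_l| ≲ |E|`. By Chebyshev's inequality
`‖f‖ / K + 1` is comparable to `2 ^ l` on at least half of each rectangle of level `l`; hence these
rectangles lie in the halo of the set `F_l` of those points of `E` where this comparison holds. The
sets `F_l` overlap boundedly (`tsum_volume_levelSet_le`), and the halo of a set is at most a constant
factor larger than the set (`haloBound_rect`). The latter is the weak type bound of the strong dyadic
maximal operator on characteristic functions; it follows from the disjointness of maximal dyadic arcs
in one variable, and passes to products by Fubini's theorem (`HaloBound.prod`).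
-/

namespace DyadicTorus

/-! ### Dyadic arcs -/

/-- The index `⌊2 ^ n x⌋` of the dyadic arc of generation `n` that contains `x`. -/
noncomputable def arcIndex (n : ℕ) (x : UnitAddCircle) : ℕ :=
  ⌊(AddCircle.equivIco (1 : ℝ) 0 x : ℝ) * 2 ^ n⌋₊

theorem mem_arc_iff {n k : ℕ} {x : UnitAddCircle} : x ∈ arc n k ↔ arcIndex n x = k := by
  have h0 : 0 ≤ (AddCircle.equivIco (1 : ℝ) 0 x : ℝ) := (AddCircle.equivIco (1 : ℝ) 0 x).2.1
  rw [arcIndex, Nat.floor_eq_iff (by positivity), arc, Set.mem_ofPred_eq, Set.mem_Ico,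
    div_le_iff₀ (by positivity), lt_div_iff₀ (by positivity)]

theorem arcIndex_lt (n : ℕ) (x : UnitAddCircle) : arcIndex n x < 2 ^ n := by
  have h0 : 0 ≤ (AddCircle.equivIco (1 : ℝ) 0 x : ℝ) := (AddCircle.equivIco (1 : ℝ) 0 x).2.1
  have h1 : (AddCircle.equivIco (1 : ℝ) 0 x : ℝ) < 1 := by
    simpa using (AddCircle.equivIco (1 : ℝ) 0 x).2.2
  rw [arcIndex, Nat.floor_lt (by positivity)]
  push_cast
  have : (0 : ℝ) < 2 ^ n := by positivity
  nlinarith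

theorem arcIndex_add (m d : ℕ) (x : UnitAddCircle) :
    arcIndex m x = arcIndex (m + d) x / 2 ^ d := by
  have := Nat.floor_div_natCast ((AddCircle.equivIco (1 : ℝ) 0 x : ℝ) * 2 ^ (m + d)) (2 ^ d)
  rw [arcIndex, arcIndex, ← this]
  congr 1
  push_cast
  rw [pow_add]
  field_simp

theorem arcIndex_of_le {m n : ℕ} (h : m ≤ n) (x : UnitAddCircle) :
    arcIndex m x = arcIndex n x / 2 ^ (n - m) := by
  obtain ⟨d, rfl⟩ := Nat.exists_eq_add_of_le h
  simpa using arcIndex_add m d x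

/-- Points in a common arc of generation `n` lie in a common arc of each earlier generation. -/
theorem arcIndex_eq_of_le {m n : ℕ} (h : m ≤ n) {x y : UnitAddCircle}
    (hxy : arcIndex n x = arcIndex n y) : arcIndex m x = arcIndex m y := by
  rw [arcIndex_of_le h x, arcIndex_of_le h y, hxy]

theorem arc_subset_of_le {m n k : ℕ} (h : m ≤ n) : arc n k ⊆ arc m (k / 2 ^ (n - m)) := by
  intro x hx
  rw [mem_arc_iff] at hx ⊢
  rw [arcIndex_of_le h, hx]

/-- Dyadic arcs are nested or disjoint. -/
theorem arc_subset_of_inter_nonempty {m n k l : ℕ} (h : m ≤ n)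
    (hne : (arc n k ∩ arc m l).Nonempty) : arc n k ⊆ arc m l := by
  obtain ⟨y, hy, hy'⟩ := hne
  intro x hx
  rw [mem_arc_iff] at *
  rw [← hy', arcIndex_eq_of_le h (hx.trans hy.symm)]

theorem volume_arc {n k : ℕ} (hk : k < 2 ^ n) :
    volume (arc n k) = ((2 : ℝ≥0∞) ^ n)⁻¹ := by
  rw [AddCircle.add_projection_respects_measure 1 0 (measurableSet_arc n k)]
  have hb : ((k : ℝ) + 1) / 2 ^ n ≤ 1 := by
    rw [div_le_one (by positivity)]
    exact_mod_cast hk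
  have ha : 0 ≤ (k : ℝ) / 2 ^ n := by positivity
  -- the two sets may differ in the end points `0` and `1`
  have key : (QuotientAddGroup.mk ⁻¹' arc n k ∩ Set.Ioc 0 (0 + 1) : Set ℝ) =ᵐ[volume]
      Set.Ico ((k : ℝ) / 2 ^ n) (((k : ℝ) + 1) / 2 ^ n) := by
    have h0 : ∀ᵐ x : ℝ, x ≠ 0 := by simp [ae_iff]
    have h1 : ∀ᵐ x : ℝ, x ≠ 1 := by simp [ae_iff]
    filter_upwards [h0, h1] with x hx0 hx1
    apply propext
    change (x ∈ QuotientAddGroup.mk ⁻¹' arc n k ∩ Set.Ioc 0 (0 + 1)) ↔ x ∈ Set.Ico _ _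
    rw [zero_add]
    have hmem : x ∈ Set.Ico (0 : ℝ) (0 + 1) →
        ((QuotientAddGroup.mk x : UnitAddCircle) ∈ arc n k ↔
          x ∈ Set.Ico ((k : ℝ) / 2 ^ n) (((k : ℝ) + 1) / 2 ^ n)) := by
      intro h
      rw [arc, Set.mem_ofPred_eq]
      have := AddCircle.equivIco_coe_eq (p := (1 : ℝ)) (a := 0) h
      change ((AddCircle.equivIco 1 0) (x : AddCircle (1 : ℝ)) : ℝ) ∈ _ ↔ _
      rw [this]
    constructor
    · rintro ⟨hx, hx'⟩
      exact (hmem ⟨hx'.1.le, by simpa using lt_of_le_of_ne hx'.2 hx1⟩).1 hx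
    · intro hx
      have hpos : 0 < x := lt_of_le_of_ne (ha.trans hx.1) hx0.symm
      have hlt : x < 1 := hx.2.trans_le hb
      exact ⟨(hmem ⟨hpos.le, by simpa using hlt⟩).2 hx, hpos, hlt.le⟩
  rw [measure_congr key, Real.volume_Ico]
  have : ((k : ℝ) + 1) / 2 ^ n - k / 2 ^ n = (2 ^ n)⁻¹ := by field_simp; ring
  rw [this, ENNReal.ofReal_inv_of_pos (by positivity), ENNReal.ofReal_pow (by norm_num)]
  simp

theorem arc_nonempty {n k : ℕ} (hk : k < 2 ^ n) : (arc n k).Nonempty := by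
  apply nonempty_of_measure_ne_zero (μ := volume)
  rw [volume_arc hk]
  simp

/-! ### Haar functions on the circle -/

theorem haar₁_eq (n k : ℕ) (x : UnitAddCircle) :
    haar₁ n k x = √((2 : ℝ) ^ n) * ((if arcIndex (n + 1) x = 2 * k + 1 then 1 else 0) -
      (if arcIndex (n + 1) x = 2 * k then 1 else 0)) := by
  classical
  simp only [haar₁, Set.indicator_apply, mem_arc_iff, Pi.one_apply]

theorem haar₁_eq_zero {n k : ℕ} {x : UnitAddCircle} (h : x ∉ arc n k) : haar₁ n k x = 0 := by
  have h2 := arcIndex_add n 1 x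
  rw [mem_arc_iff] at h
  rw [haar₁_eq, if_neg (by omega), if_neg (by omega)]
  simp

/-- `h_I` is constant on the dyadic arcs shorter than `I`. -/
theorem haar₁_congr {m n k : ℕ} (h : m < n) {x y : UnitAddCircle}
    (hxy : arcIndex n x = arcIndex n y) : haar₁ m k x = haar₁ m k y := by
  rw [haar₁_eq, haar₁_eq, arcIndex_eq_of_le h hxy]

theorem integral_haar₁ {n k : ℕ} (hk : k < 2 ^ n) : ∫ x, haar₁ n k x = 0 := by
  have h1 : 2 * k + 1 < 2 ^ (n + 1) := by rw [pow_succ]; omega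
  have h2 : 2 * k < 2 ^ (n + 1) := by omega
  have e (j : ℕ) : Integrable ((arc (n + 1) j).indicator (1 : UnitAddCircle → ℝ)) :=
    (integrable_const (1 : ℝ)).indicator (measurableSet_arc _ _)
  simp only [haar₁]
  rw [integral_const_mul, integral_sub (e _) (e _),
    integral_indicator_one (measurableSet_arc _ _), integral_indicator_one (measurableSet_arc _ _),
    measureReal_def, measureReal_def, volume_arc h1, volume_arc h2]
  simp

theorem haar₁_mul_self (n k : ℕ) (x : UnitAddCircle) :
    haar₁ n k x * haar₁ n k x = 2 ^ n * (arc n k).indicator 1 x := by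
  have h2 := arcIndex_add n 1 x
  have hs : √((2 : ℝ) ^ n) * √((2 : ℝ) ^ n) = 2 ^ n := Real.mul_self_sqrt (by positivity)
  classical
  rw [haar₁_eq, Set.indicator_apply, mem_arc_iff]
  simp only [pow_one, Pi.one_apply] at h2 ⊢
  by_cases ho : arcIndex (n + 1) x = 2 * k + 1
  · rw [if_pos ho, if_neg (by omega), if_pos (by omega)]
    linear_combination hs
  · by_cases he : arcIndex (n + 1) x = 2 * k
    · rw [if_neg ho, if_pos he, if_pos (by omega)]
      linear_combination hs
    · rw [if_neg ho, if_neg he, if_neg (by omega)]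
      ring

theorem integral_haar₁_mul_self {n k : ℕ} (hk : k < 2 ^ n) :
    ∫ x, haar₁ n k x * haar₁ n k x = 1 := by
  simp only [haar₁_mul_self]
  rw [integral_const_mul, integral_indicator_one (measurableSet_arc _ _), measureReal_def,
    volume_arc hk]
  simp

theorem integral_haar₁_mul_of_lt {m n k l : ℕ} (h : m < n) (hk : k < 2 ^ n) :
    ∫ x, haar₁ m l x * haar₁ n k x = 0 := by
  obtain ⟨y, hy⟩ := arc_nonempty hk
  have : ∀ x, haar₁ m l x * haar₁ n k x = haar₁ m l y * haar₁ n k x := by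
    intro x
    by_cases hx : x ∈ arc n k
    · rw [mem_arc_iff] at hx hy
      rw [haar₁_congr h (hx.trans hy.symm)]
    · simp [haar₁_eq_zero hx]
  simp only [this]
  rw [integral_const_mul, integral_haar₁ hk, mul_zero]

theorem integral_haar₁_mul_of_ne {n k l : ℕ} (h : k ≠ l) :
    ∫ x, haar₁ n k x * haar₁ n l x = 0 := by
  have : ∀ x, haar₁ n k x * haar₁ n l x = 0 := by
    intro x
    by_cases hx : x ∈ arc n k
    · rw [mem_arc_iff] at hx
      rw [haar₁_eq_zero (k := l) (by rw [mem_arc_iff]; omega), mul_zero]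
    · simp [haar₁_eq_zero hx]
  simp [this]

theorem integral_haar₁_mul {m n k l : ℕ} (hk : k < 2 ^ m) (hl : l < 2 ^ n)
    (h : ¬(m = n ∧ k = l)) : ∫ x, haar₁ m k x * haar₁ n l x = 0 := by
  rcases lt_trichotomy m n with hmn | rfl | hmn
  · exact integral_haar₁_mul_of_lt hmn hl
  · exact integral_haar₁_mul_of_ne (by tauto)
  · simp only [mul_comm (haar₁ m k _)]
    exact integral_haar₁_mul_of_lt hmn hk

/-! ### Halos of families of sets -/

section Halo

variable {X Y ι κ : Type*} [MeasurableSpace X] [MeasurableSpace Y]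

/-- The halo of `F`: the union of those sets `B i` of which `F` fills at least the proportion
`c`. -/
def halo (μ : Measure X) (B : ι → Set X) (c : ℝ≥0) (F : Set X) : Set X :=
  ⋃ i ∈ {i | c * μ (B i) ≤ μ (B i ∩ F)}, B i

/-- Halos are, for each fixed proportion, at most a constant factor larger than the set. This is
the weak type inequality for the maximal operator of the family `B`, restricted to characteristic
functions. -/
def HaloBound (μ : Measure X) (B : ι → Set X) : Prop :=
  ∀ c : ℝ≥0, c ≠ 0 → ∃ A : ℝ≥0, ∀ F, MeasurableSet F → μ (halo μ B c F) ≤ A * μ F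

theorem mem_halo {μ : Measure X} {B : ι → Set X} {c : ℝ≥0} {F : Set X} {x : X} :
    x ∈ halo μ B c F ↔ ∃ i, c * μ (B i) ≤ μ (B i ∩ F) ∧ x ∈ B i := by
  simp [halo]

variable {μ : Measure X} {ν : Measure Y}

/-- If `F` fills the proportion `c` of `B ×ˢ D`, then for at least the proportion `c / 2` of the
points `x ∈ B` the section of `F` at `x` fills the proportion `c / 2` of `D`. -/
theorem le_measure_section [IsFiniteMeasure μ] [IsFiniteMeasure ν] {B : Set X} {D : Set Y}
    (hB : MeasurableSet B) (hD : MeasurableSet D) (hD0 : ν D ≠ 0) {F : Set (X × Y)}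
    (hF : MeasurableSet F) {c : ℝ≥0} (h : c * μ.prod ν (B ×ˢ D) ≤ μ.prod ν (B ×ˢ D ∩ F)) :
    (c / 2 : ℝ≥0) * μ B ≤
      μ (B ∩ {x | (c / 2 : ℝ≥0) * ν D ≤ ν (D ∩ Prod.mk x ⁻¹' F)}) := by
  set T := {x | (c / 2 : ℝ≥0) * ν D ≤ ν (D ∩ Prod.mk x ⁻¹' F)} with hT
  have hm : Measurable fun x => ν (D ∩ Prod.mk x ⁻¹' F) := by
    have := measurable_measure_prodMk_left (ν := ν) ((MeasurableSet.univ.prod hD).inter hF)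
    simpa [Set.preimage_inter, Set.mk_preimage_prod_right] using this
  have hTm : MeasurableSet T := measurableSet_le measurable_const hm
  have h1 : μ.prod ν (B ×ˢ D ∩ F) ≤ ν D * μ (B ∩ T) + (c / 2 : ℝ≥0) * ν D * μ B := by
    rw [Measure.prod_apply ((hB.prod hD).inter hF)]
    calc ∫⁻ x, ν (Prod.mk x ⁻¹' (B ×ˢ D ∩ F)) ∂μ
        ≤ ∫⁻ x, ((B ∩ T).indicator (fun _ => ν D) x +
            B.indicator (fun _ => (c / 2 : ℝ≥0) * ν D) x) ∂μ := by
          refine lintegral_mono fun x => ?_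
          by_cases hx : x ∈ B
          · rw [Set.preimage_inter, Set.mk_preimage_prod_right hx]
            by_cases hx' : x ∈ T
            · simp only [hx, hx', Set.mem_inter_iff, Set.indicator_of_mem, and_self]
              exact le_add_right (measure_mono Set.inter_subset_left)
            · simp only [hx, hx', Set.mem_inter_iff, Set.indicator_of_mem, and_false,
                not_false_eq_true, Set.indicator_of_notMem, zero_add]
              exact (not_le.1 hx').le
          · rw [Set.preimage_inter, Set.mk_preimage_prod_right_eq_empty hx]
            simp
      _ = _ := by
          rw [lintegral_add_left (measurable_const.indicator (hB.inter hTm)),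
            lintegral_indicator (hB.inter hTm), lintegral_indicator hB]
          simp
  rw [Measure.prod_prod] at h
  have h2 := h.trans h1
  have h3 : (c : ℝ≥0∞) = (c / 2 : ℝ≥0) + (c / 2 : ℝ≥0) := by
    rw [← ENNReal.coe_add, add_halves]
  have h4 : ν D * ((c / 2 : ℝ≥0) * μ B) + (c / 2 : ℝ≥0) * ν D * μ B ≤
      ν D * μ (B ∩ T) + (c / 2 : ℝ≥0) * ν D * μ B := by
    refine le_trans (le_of_eq ?_) h2
    rw [h3]; ring
  have h5 := (ENNReal.add_le_add_iff_right (by finiteness)).1 h4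
  exact (ENNReal.mul_le_mul_iff_right hD0 (measure_ne_top _ _)).1 h5

/-- Halo bounds pass to products, by applying them to the sections in one variable after the
other. -/
theorem HaloBound.prod [Countable ι] [Countable κ] [IsFiniteMeasure μ] [IsFiniteMeasure ν]
    {B : ι → Set X} {D : κ → Set Y} (hB : ∀ i, MeasurableSet (B i))
    (hD : ∀ k, MeasurableSet (D k)) (hD0 : ∀ k, ν (D k) ≠ 0) (h : HaloBound μ B)
    (h' : HaloBound ν D) : HaloBound (μ.prod ν) fun p : ι × κ => B p.1 ×ˢ D p.2 := by
  intro c hc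
  obtain ⟨A, hA⟩ := h (c / 2) (by positivity)
  obtain ⟨A', hA'⟩ := h' (c / 2) (by positivity)
  refine ⟨A * A', fun F hF => ?_⟩
  -- `G` is the halo of `F` in the second variable, `H` the halo of `G` in the first one
  set G : Set (X × Y) := {p | p.2 ∈ halo ν D (c / 2) (Prod.mk p.1 ⁻¹' F)} with hG
  set H : Set (X × Y) := {p | p.1 ∈ halo μ B (c / 2) ((fun x => (x, p.2)) ⁻¹' G)} with hH
  have hGm : MeasurableSet G := by
    have : G = ⋃ k, {x | (c / 2 : ℝ≥0) * ν (D k) ≤ ν (D k ∩ Prod.mk x ⁻¹' F)} ×ˢ D k := by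
      ext p
      simp [hG, mem_halo]
    rw [this]
    refine MeasurableSet.iUnion fun k => MeasurableSet.prod (measurableSet_le measurable_const ?_)
      (hD k)
    have := measurable_measure_prodMk_left (ν := ν) ((MeasurableSet.univ.prod (hD k)).inter hF)
    simpa [Set.preimage_inter, Set.mk_preimage_prod_right] using this
  have hHm : MeasurableSet H := by
    have : H = ⋃ i, B i ×ˢ {y | (c / 2 : ℝ≥0) * μ (B i) ≤ μ (B i ∩ (fun x => (x, y)) ⁻¹' G)} := by
      ext p
      simp [hH, mem_halo, and_comm]
    rw [this]
    refine MeasurableSet.iUnion fun i => MeasurableSet.prod (hB i)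
      (measurableSet_le measurable_const ?_)
    have := measurable_measure_prodMk_right (μ := μ) (((hB i).prod MeasurableSet.univ).inter hGm)
    simpa [Set.preimage_inter, Set.mk_preimage_prod_left] using this
  have hsub : halo (μ.prod ν) (fun p : ι × κ => B p.1 ×ˢ D p.2) c F ⊆ H := by
    rintro ⟨x, y⟩ hxy
    obtain ⟨⟨i, k⟩, hik, hx, hy⟩ := mem_halo.1 hxy
    refine mem_halo.2 ⟨i, ?_, hx⟩
    refine (le_measure_section (hB i) (hD k) (hD0 k) hF hik).trans (measure_mono ?_)
    rintro x' ⟨hx', hx''⟩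
    exact ⟨hx', mem_halo.2 ⟨k, hx'', hy⟩⟩
  calc (μ.prod ν) (halo (μ.prod ν) (fun p : ι × κ => B p.1 ×ˢ D p.2) c F)
      ≤ (μ.prod ν) H := measure_mono hsub
    _ = ∫⁻ y, μ (halo μ B (c / 2) ((fun x => (x, y)) ⁻¹' G)) ∂ν := by
        rw [Measure.prod_apply_symm hHm]; rfl
    _ ≤ ∫⁻ y, A * μ ((fun x => (x, y)) ⁻¹' G) ∂ν :=
        lintegral_mono fun y => hA _ (measurable_prodMk_right hGm)
    _ = A * (μ.prod ν) G := by
        rw [lintegral_const_mul' _ _ ENNReal.coe_ne_top, Measure.prod_apply_symm hGm]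
    _ = A * ∫⁻ x, ν (halo ν D (c / 2) (Prod.mk x ⁻¹' F)) ∂μ := by
        rw [Measure.prod_apply hGm]; rfl
    _ ≤ A * ∫⁻ x, A' * ν (Prod.mk x ⁻¹' F) ∂μ := by
        gcongr with x
        exact hA' _ (measurable_prodMk_left hF)
    _ = (A * A' : ℝ≥0) * (μ.prod ν) F := by
        rw [lintegral_const_mul' _ _ ENNReal.coe_ne_top, Measure.prod_apply hF, ENNReal.coe_mul,
          mul_assoc]

theorem HaloBound.pi [Countable ι] [IsFiniteMeasure μ] {B : ι → Set X}
    (hB : ∀ i, MeasurableSet (B i)) (hB0 : ∀ i, μ (B i) ≠ 0) (h : HaloBound μ B) (n : ℕ) :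
    HaloBound (Measure.pi fun _ : Fin n => μ)
      fun p : Fin n → ι => Set.univ.pi fun i => B (p i) := by
  induction n with
  | zero =>
    intro c hc
    refine ⟨c⁻¹, fun F _ => ?_⟩
    set π := Measure.pi fun _ : Fin 0 => μ
    rcases Set.eq_empty_or_nonempty (halo π (fun p : Fin 0 → ι => Set.univ.pi fun i => B (p i)) c F)
      with he | ⟨x, hx⟩
    · rw [he]; simp
    · obtain ⟨p, hp, -⟩ := mem_halo.1 hx
      have huniv : (Set.univ.pi fun i => B (p i)) = Set.univ := by ext; simp
      rw [huniv, Set.univ_inter] at hp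
      rw [ENNReal.coe_inv hc, ← ENNReal.div_eq_inv_mul, ENNReal.le_div_iff_mul_le (by simp [hc])
        (by simp), mul_comm]
      exact (mul_le_mul_right (measure_mono (Set.subset_univ _)) _).trans hp
  | succ n ih =>
    intro c hc
    have hpi : ∀ p : Fin n → ι, MeasurableSet (Set.univ.pi fun i => B (p i)) :=
      fun p => MeasurableSet.univ_pi fun i => hB _
    have hpi0 : ∀ p : Fin n → ι,
        (Measure.pi fun _ : Fin n => μ) (Set.univ.pi fun i => B (p i)) ≠ 0 := fun p => by
      rw [Measure.pi_pi]
      exact Finset.prod_ne_zero_iff.2 fun i _ => hB0 _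
    obtain ⟨A, hA⟩ := HaloBound.prod hB hpi hpi0 h ih c hc
    refine ⟨A, fun F hF => ?_⟩
    have he := measurePreserving_piFinSuccAbove (fun _ : Fin (n + 1) => μ) 0
    set e := MeasurableEquiv.piFinSuccAbove (fun _ : Fin (n + 1) => X) 0 with hedef
    have hpre : ∀ p : Fin (n + 1) → ι, (Set.univ.pi fun i => B (p i)) =
        e ⁻¹' (B (p 0) ×ˢ Set.univ.pi fun i => B (p i.succ)) := by
      intro p
      ext x
      simp [hedef, Fin.forall_fin_succ, Fin.tail, MeasurableEquiv.piFinSuccAbove]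
    have hFe : F = e ⁻¹' (e.symm ⁻¹' F) := by
      rw [← Set.preimage_comp, e.symm_comp_self, Set.preimage_id]
    have hF' : MeasurableSet (e.symm ⁻¹' F) := e.symm.measurable hF
    have hsub : halo (Measure.pi fun _ : Fin (n + 1) => μ)
        (fun p : Fin (n + 1) → ι => Set.univ.pi fun i => B (p i)) c F ⊆
        e ⁻¹' halo (μ.prod (Measure.pi fun _ : Fin n => μ))
          (fun p : ι × (Fin n → ι) => B p.1 ×ˢ Set.univ.pi fun i => B (p.2 i)) c
          (e.symm ⁻¹' F) := by
      intro x hx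
      obtain ⟨p, hp, hx⟩ := mem_halo.1 hx
      refine mem_halo.2 ⟨(p 0, fun i => p i.succ), ?_, ?_⟩
      · rw [hpre, hFe, ← Set.preimage_inter] at hp
        rwa [he.measure_preimage_equiv, he.measure_preimage_equiv] at hp
      · rw [hpre] at hx
        exact hx
    calc _ ≤ _ := measure_mono hsub
      _ = _ := he.measure_preimage_equiv _
      _ ≤ _ := hA _ hF'
      _ = A * (Measure.pi fun _ : Fin (n + 1) => μ) F := by
        conv_rhs => rw [hFe]
        rw [he.measure_preimage_equiv]

end Halo

/-- In one variable halos are controlled by the disjointness of the maximal arcs. -/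
theorem haloBound_arc :
    HaloBound volume fun I : (n : ℕ) × Fin (2 ^ n) => arc I.1 I.2 := by
  intro c hc
  refine ⟨c⁻¹, fun F hF => ?_⟩
  -- the enlargement factor `3 / 2 < 2` forces the selected arc to be at least as long
  set B : (n : ℕ) × Fin (2 ^ n) → Set UnitAddCircle := fun I => arc I.1 I.2
  set t := {I | c * volume (B I) ≤ volume (B I ∩ F)}
  obtain ⟨u, hut, hu, hcov⟩ := Vitali.exists_disjoint_subfamily_covering_enlargement B t
    (fun I => (1 / 2 : ℝ) ^ I.1) (3 / 2) (by norm_num) (fun _ _ => by positivity) 1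
    (fun _ _ => pow_le_one₀ (by norm_num) (by norm_num)) (fun I _ => arc_nonempty I.2.2)
  have hsub : halo volume B c F ⊆ ⋃ I ∈ u, B I := by
    intro x hx
    obtain ⟨I, hI, hx⟩ := mem_halo.1 hx
    obtain ⟨J, hJ, hne, hle⟩ := hcov I hI
    refine Set.mem_biUnion hJ (arc_subset_of_inter_nonempty ?_ hne hx)
    by_contra hlt
    have h1 : (1 / 2 : ℝ) ^ J.1 ≤ (1 / 2) ^ (I.1 + 1) :=
      pow_le_pow_of_le_one (by norm_num) (by norm_num) (by omega)
    rw [pow_succ] at h1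
    have h2 : (0 : ℝ) < (1 / 2) ^ I.1 := by positivity
    linarith
  have hdisj : u.PairwiseDisjoint fun I => B I ∩ F := fun I hI J hJ hIJ =>
    (hu hI hJ hIJ).mono Set.inter_subset_left Set.inter_subset_left
  calc volume (halo volume B c F) ≤ volume (⋃ I ∈ u, B I) := measure_mono hsub
    _ ≤ ∑' I : u, volume (B I) := measure_biUnion_le _ u.to_countable _
    _ ≤ ∑' I : u, (c⁻¹ : ℝ≥0) * volume (B I ∩ F) := by
        refine ENNReal.tsum_le_tsum fun I => ?_
        rw [ENNReal.coe_inv hc, ← ENNReal.div_eq_inv_mul, ENNReal.le_div_iff_mul_le (by simp [hc])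
          (by simp), mul_comm]
        exact hut I.2
    _ = (c⁻¹ : ℝ≥0) * volume (⋃ I ∈ u, B I ∩ F) := by
        rw [ENNReal.tsum_mul_left, measure_biUnion u.to_countable hdisj
          fun I _ => (measurableSet_arc _ _).inter hF]
    _ ≤ (c⁻¹ : ℝ≥0) * volume F := by
        gcongr
        exact Set.iUnion₂_subset fun I _ => Set.inter_subset_right

variable {N : ℕ}

/-! ### Dyadic rectangles -/

theorem Rect.toSet_eq_pi (R : Rect N) :
    R.toSet = Set.univ.pi fun i => arc (R.1 i) (R.2 i) := by
  ext x
  simp [Rect.toSet]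

theorem Rect.mem_toSet_iff {R : Rect N} {x : UnitAddTorus (Fin N)} :
    x ∈ R.toSet ↔ ∀ i, arcIndex (R.1 i) (x i) = R.2 i := by
  simp only [← mem_arc_iff]
  rfl

theorem Rect.measurableSet_toSet (R : Rect N) : MeasurableSet R.toSet := by
  rw [Rect.toSet_eq_pi]
  exact MeasurableSet.univ_pi fun i => measurableSet_arc _ _

theorem Rect.volume_toSet (R : Rect N) :
    volume R.toSet = ∏ i, ((2 : ℝ≥0∞) ^ R.1 i)⁻¹ := by
  rw [Rect.toSet_eq_pi, volume_pi_pi]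
  exact Finset.prod_congr rfl fun i _ => volume_arc (R.2 i).2

theorem Rect.volume_toSet_ne_zero (R : Rect N) : volume R.toSet ≠ 0 := by
  rw [R.volume_toSet]
  exact Finset.prod_ne_zero_iff.2 fun i _ => by simp

theorem Rect.toSet_nonempty (R : Rect N) : R.toSet.Nonempty :=
  nonempty_of_measure_ne_zero R.volume_toSet_ne_zero

/-- The dyadic rectangle of generation `j` that contains a rectangle of later generation. -/
def Rect.ancestor (R : Rect N) (j : Fin N → ℕ) (h : j ≤ R.1) : Rect N :=
  ⟨j, fun i => ⟨R.2 i / 2 ^ (R.1 i - j i), by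
    rw [Nat.div_lt_iff_lt_mul (by positivity), ← pow_add, Nat.add_sub_cancel' (h i)]
    exact (R.2 i).2⟩⟩

theorem Rect.toSet_subset_ancestor (R : Rect N) (j : Fin N → ℕ) (h : j ≤ R.1) :
    R.toSet ⊆ (R.ancestor j h).toSet :=
  fun _ hx i => arc_subset_of_le (h i) (hx i)

theorem Rect.pairwise_disjoint (j : Fin N → ℕ) :
    Pairwise fun p q : Pos j => Disjoint (Rect.toSet ⟨j, p⟩) (Rect.toSet ⟨j, q⟩) := by
  intro p q hpq
  rw [Set.disjoint_left]
  intro x hx hx'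
  rw [Rect.mem_toSet_iff] at hx hx'
  exact hpq (funext fun i => Fin.ext ((hx i).symm.trans (hx' i)))

/-- The whole torus as a dyadic rectangle. -/
def Rect.root (N : ℕ) : Rect N := ⟨0, fun _ => ⟨0, by simp⟩⟩

theorem Rect.toSet_root : (Rect.root N).toSet = Set.univ := by
  ext x
  simp only [Rect.mem_toSet_iff, Set.mem_univ, iff_true]
  intro i
  have := arcIndex_lt 0 (x i)
  simpa [Rect.root] using this

theorem volume_univ_torus : volume (Set.univ : Set (UnitAddTorus (Fin N))) = 1 := by
  rw [← Rect.toSet_root, Rect.volume_toSet]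
  simp [Rect.root]

theorem Rect.volume_ancestor_update (R : Rect N) (i : Fin N) (n : ℕ) (h : R.1 i = n + 1)
    (h' : Function.update R.1 i n ≤ R.1) :
    volume (R.ancestor _ h').toSet = 2 * volume R.toSet := by
  classical
  rw [Rect.volume_toSet, Rect.volume_toSet, ← Finset.mul_prod_erase _ _ (Finset.mem_univ i),
    ← Finset.mul_prod_erase _ _ (Finset.mem_univ i), ← mul_assoc]
  congr 1
  · rw [h, pow_succ, ENNReal.mul_inv (by simp) (by simp), mul_comm, mul_assoc,
      ENNReal.inv_mul_cancel (by simp) (by simp)]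
    simp [Rect.ancestor]
  · refine Finset.prod_congr rfl fun k hk => ?_
    simp [Rect.ancestor, Function.update_of_ne (Finset.ne_of_mem_erase hk)]

theorem haloBound_rect (N : ℕ) : HaloBound volume fun R : Rect N => R.toSet := by
  intro c hc
  obtain ⟨A, hA⟩ := haloBound_arc.pi (fun I => measurableSet_arc _ _)
    (fun I => by rw [volume_arc I.2.2]; simp) N c hc
  refine ⟨A, fun F hF => (measure_mono ?_).trans (hA F hF)⟩
  intro x hx
  obtain ⟨R, hR, hx⟩ := mem_halo.1 hx
  refine mem_halo.2 ⟨fun i => ⟨R.1 i, R.2 i⟩, ?_, ?_⟩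
  · rwa [Rect.toSet_eq_pi] at hR
  · rwa [Rect.toSet_eq_pi] at hx

/-! ### Orthonormality of the Haar system -/

variable {𝕜 : Type*} [RCLike 𝕜]

theorem orthonormal_haar (𝕜 : Type*) [RCLike 𝕜] (N : ℕ) : Orthonormal 𝕜 (haar 𝕜 (N := N)) := by
  have key : ∀ R S : Rect N, inner 𝕜 (haar 𝕜 R) (haar 𝕜 S) =
      ((∏ i, ∫ x, haar₁ (R.1 i) (R.2 i) x * haar₁ (S.1 i) (S.2 i) x : ℝ) : 𝕜) := by
    intro R S
    rw [L2.inner_def, ← integral_fintype_prod_volume_eq_prod, ← integral_ofReal]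
    refine integral_congr_ae ?_
    filter_upwards [(memLp_haarFun 𝕜 R).coeFn_toLp, (memLp_haarFun 𝕜 S).coeFn_toLp] with x hR hS
    rw [haar, haar, hR, hS]
    simp [haarFun, Finset.prod_mul_distrib, mul_comm]
  classical
  rw [orthonormal_iff_ite]
  intro R S
  rw [key]
  split_ifs with h
  · subst h
    rw [Finset.prod_congr rfl fun i _ => integral_haar₁_mul_self (R.2 i).2]
    simp
  · have : ∃ i, ¬(R.1 i = S.1 i ∧ (R.2 i : ℕ) = S.2 i) := by
      by_contra! hc
      obtain ⟨j, p⟩ := R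
      obtain ⟨k, q⟩ := S
      obtain rfl : j = k := funext fun i => (hc i).1
      exact h (by rw [show p = q from funext fun i => Fin.ext (hc i).2])
    obtain ⟨i, hi⟩ := this
    rw [Finset.prod_eq_zero (Finset.mem_univ i) (integral_haar₁_mul (R.2 i).2 (S.2 i).2 hi)]
    simp

theorem summable_smul_haar_iff {a : Rect N → 𝕜} :
    (Summable fun R => a R • haar 𝕜 R) ↔ Summable fun R => ‖a R‖ ^ 2 := by
  have := (orthonormal_haar 𝕜 N).orthogonalFamily.summable_iff_norm_sq_summable a
  simpa using this

theorem coeff_tsum_smul_haar {a : Rect N → 𝕜} (h : Summable fun R => a R • haar 𝕜 R)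
    (R : Rect N) : coeff (∑' S, a S • haar 𝕜 S) R = a R := by
  classical
  have h1 := h.hasSum.mapL (innerSL 𝕜 (haar 𝕜 R))
  have h2 : ∀ S, innerSL 𝕜 (haar 𝕜 R) (a S • haar 𝕜 S) = if R = S then a S else 0 := by
    intro S
    rw [innerSL_apply_apply, inner_smul_right, orthonormal_iff_ite.1 (orthonormal_haar 𝕜 N) R S]
    simp
  simp only [h2] at h1
  have h3 := hasSum_single (f := fun S => if R = S then a S else 0) R
    (fun S hS => if_neg hS.symm)
  rw [if_pos rfl] at h3
  exact h1.unique h3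

/-- Bessel's inequality for the Haar system, in qualitative form. -/
theorem summable_norm_coeff_sq (f : L2 𝕜 N) : Summable fun R => ‖coeff f R‖ ^ 2 :=
  (orthonormal_haar 𝕜 N).inner_products_summable f

theorem coeff_tailProj (j : Fin N → ℕ) (f : L2 𝕜 N) (R : Rect N) [Decidable (j ≤ R.1)] :
    coeff (tailProj j f) R = if j ≤ R.1 then coeff f R else 0 := by
  classical
  -- the series of `tailProj` converges, so its sum is not a junk value
  set a : Rect N → 𝕜 := fun R => if j ≤ R.1 then coeff f R else 0 with ha
  have hs : Summable fun R => a R • haar 𝕜 R := by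
    rw [summable_smul_haar_iff]
    refine Summable.of_nonneg_of_le (fun _ => by positivity) (fun R => ?_)
      (summable_norm_coeff_sq f)
    simp only [ha]
    split_ifs <;> simp
  have h1 := hs.hasSum.sigma fun k => hasSum_fintype fun p : Pos k => a ⟨k, p⟩ • haar 𝕜 ⟨k, p⟩
  have hsub : Function.support (fun k => ∑ p : Pos k, a ⟨k, p⟩ • haar 𝕜 ⟨k, p⟩) ⊆ {k | j ≤ k} := by
    intro k hk
    by_contra hjk
    refine hk (Finset.sum_eq_zero fun p _ => ?_)
    have : ¬ j ≤ k := hjk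
    simp [ha, this]
  have h2 := (hasSum_subtype_iff_of_support_subset hsub).2 h1
  have h3 : tailProj j f = ∑' R, a R • haar 𝕜 R := by
    rw [← h2.tsum_eq, tailProj]
    refine tsum_congr fun k => Finset.sum_congr rfl fun p _ => ?_
    have : j ≤ k.1 := k.2
    simp [ha, this]
  rw [h3, coeff_tsum_smul_haar hs]
  simp only [ha]
  split_ifs <;> rfl

/-! ### The energy of a function on a set -/

/-- The energy `∑_{R ⊆ E} |f_R|²` of the Haar coefficients of `f` that live on the set `E`. -/
noncomputable def energy (f : L2 𝕜 N) (E : Set (UnitAddTorus (Fin N))) : ℝ≥0∞ :=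
  ∑' R : {R : Rect N // R.toSet ⊆ E}, ‖coeff f R‖ₑ ^ 2

theorem energy_mono (f : L2 𝕜 N) {E F : Set (UnitAddTorus (Fin N))} (h : E ⊆ F) :
    energy f E ≤ energy f F :=
  ENNReal.tsum_mono_subtype (fun R => ‖coeff f R‖ₑ ^ 2)
    (s := {R : Rect N | R.toSet ⊆ E}) (t := {R | R.toSet ⊆ F}) fun _ hR => hR.trans h

theorem energy_empty (f : L2 𝕜 N) : energy f ∅ = 0 := by
  have : IsEmpty {R : Rect N // R.toSet ⊆ ∅} :=
    ⟨fun R => R.1.toSet_nonempty.ne_empty (Set.subset_empty_iff.1 R.2)⟩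
  exact tsum_empty

/-- Open sets may be replaced by arbitrary sets in the norm of product BMO, by outer regularity of
the measure. -/
theorem productBMONorm_le_iff {f : L2 𝕜 N} {c : ℝ≥0∞} (hc : c ≠ ∞) :
    productBMONorm f ≤ c ↔ ∀ E, energy f E ≤ c ^ 2 * volume E := by
  have h1 : productBMONorm f ≤ c ↔
      ∀ Ω : Set (UnitAddTorus (Fin N)), IsOpen Ω → Ω.Nonempty →
        energy f Ω ≤ c ^ 2 * volume Ω := by
    rw [productBMONorm, one_div, ENNReal.rpow_inv_le_iff (by norm_num)]
    simp only [iSup_le_iff, ENNReal.rpow_ofNat]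
    refine forall_congr' fun Ω => forall_congr' fun hΩ => forall_congr' fun hne => ?_
    rw [ENNReal.inv_mul_le_iff (hΩ.measure_ne_zero _ hne) (measure_ne_top _ _), mul_comm]
    rfl
  rw [h1]
  refine ⟨fun h E => ?_, fun h Ω _ _ => h Ω⟩
  have h2 : ∀ U : Set (UnitAddTorus (Fin N)), IsOpen U → E ⊆ U →
      energy f E ≤ c ^ 2 * volume U := by
    intro U hU hEU
    rcases U.eq_empty_or_nonempty with rfl | hne
    · rw [Set.subset_empty_iff.1 hEU, energy_empty]; simp
    · exact (energy_mono f hEU).trans (h U hU hne)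
  rcases eq_or_ne c 0 with rfl | hc0
  · simpa using h2 Set.univ isOpen_univ (Set.subset_univ _)
  · have hc2 : c ^ 2 ≠ 0 := pow_ne_zero _ hc0
    have hc3 : c ^ 2 ≠ ∞ := ENNReal.pow_ne_top hc
    rw [mul_comm, ← ENNReal.div_le_iff hc2 hc3, Set.measure_eq_iInf_isOpen]
    refine le_iInf fun U => le_iInf fun hEU => le_iInf fun hU => ?_
    rw [ENNReal.div_le_iff hc2 hc3, mul_comm]
    exact h2 U hU hEU

theorem energy_eq_tsum_indicator (f : L2 𝕜 N) (E : Set (UnitAddTorus (Fin N))) :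
    energy f E = ∑' R, {R : Rect N | R.toSet ⊆ E}.indicator (fun R => ‖coeff f R‖ₑ ^ 2) R :=
  tsum_subtype {R : Rect N | R.toSet ⊆ E} fun R => ‖coeff f R‖ₑ ^ 2

/-! ### Means and oscillations -/

theorem integrable_L2 (f : L2 𝕜 N) : Integrable f :=
  (Lp.memLp f).integrable (by norm_num)

theorem enorm_mean_sub_le (f : L2 𝕜 N) (R : Rect N) (c : 𝕜) :
    ‖mean f R - c‖ₑ ≤ (volume R.toSet)⁻¹ * ∫⁻ x in R.toSet, ‖f x - c‖ₑ := by
  have hv : volume.real R.toSet ≠ 0 :=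
    (measureReal_ne_zero_iff (measure_ne_top _ _)).2 R.volume_toSet_ne_zero
  have h : mean f R - c = (volume.real R.toSet)⁻¹ • ∫ x in R.toSet, (f x - c) := by
    rw [integral_sub (integrable_L2 f).integrableOn (integrable_const c), mean, setAverage_eq,
      smul_sub, setIntegral_const, smul_smul, inv_mul_cancel₀ hv, one_smul]
  rw [h, enorm_smul]
  gcongr
  · rw [Real.enorm_eq_ofReal (by positivity), ENNReal.ofReal_inv_of_pos
      (lt_of_le_of_ne measureReal_nonneg hv.symm), measureReal_def,
      ENNReal.ofReal_toReal (measure_ne_top _ _)]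
  · exact enorm_integral_le_lintegral_enorm _

/-- The mean is, up to a factor of two, the best constant in the mean oscillation. -/
theorem oscillation_le_two_mul (f : L2 𝕜 N) (R : Rect N) (c : 𝕜) :
    (volume R.toSet)⁻¹ * ∫⁻ x in R.toSet, ‖f x - mean f R‖ₑ ≤
      2 * ((volume R.toSet)⁻¹ * ∫⁻ x in R.toSet, ‖f x - c‖ₑ) := by
  have h : ∫⁻ x in R.toSet, ‖f x - mean f R‖ₑ ≤
      (∫⁻ x in R.toSet, ‖f x - c‖ₑ) + ‖mean f R - c‖ₑ * volume R.toSet := by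
    calc ∫⁻ x in R.toSet, ‖f x - mean f R‖ₑ
        ≤ ∫⁻ x in R.toSet, (‖f x - c‖ₑ + ‖mean f R - c‖ₑ) := by
          refine lintegral_mono fun x => ?_
          have : f x - mean f R = (f x - c) - (mean f R - c) := by ring
          rw [this]
          exact enorm_sub_le
      _ = _ := by
          rw [lintegral_add_right _ measurable_const, lintegral_const, Measure.restrict_apply_univ]
  calc _ ≤ (volume R.toSet)⁻¹ *
        ((∫⁻ x in R.toSet, ‖f x - c‖ₑ) + ‖mean f R - c‖ₑ * volume R.toSet) := by gcongr
    _ = (volume R.toSet)⁻¹ * (∫⁻ x in R.toSet, ‖f x - c‖ₑ) + ‖mean f R - c‖ₑ := by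
        rw [mul_add, mul_left_comm, ENNReal.inv_mul_cancel R.volume_toSet_ne_zero
          (measure_ne_top _ _), mul_one]
    _ ≤ _ := by
        rw [two_mul]
        gcongr
        exact enorm_mean_sub_le f R c

theorem lintegral_rect_eval_le (R : Rect N) (i : Fin N) {g : UnitAddCircle → ℝ≥0∞}
    (hg : Measurable g)
    (h : ∫⁻ t in arc (R.1 i) (R.2 i), g t ≤ volume (arc (R.1 i) (R.2 i))) :
    ∫⁻ x in R.toSet, g (x i) ≤ volume R.toSet := by
  classical
  rw [Rect.toSet_eq_pi, volume_pi, Measure.restrict_pi_pi, ← lintegral_map hg (measurable_pi_apply i),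
    ← Measure.restrict_apply_univ, Measure.restrict_pi_pi, Measure.pi_univ]
  have := Measure.pi_map_eval (μ := fun i => volume.restrict (arc (R.1 i) (R.2 i))) i
  change Measure.map (fun x : UnitAddTorus (Fin N) => x i) _ = _ at this
  rw [this, lintegral_smul_measure, smul_eq_mul, ← Finset.mul_prod_erase _ _ (Finset.mem_univ i),
    mul_comm]
  gcongr
  simpa using h

/-! ### The logarithmic test functions -/

/-- The number of dyadic arcs that contain both `t` and the arc `arc n k`: a dyadic version of the
function `log (1 / |t - t₀|)`, truncated at the scale `2 ^ (-n)`. -/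
noncomputable def logFun (n k : ℕ) (t : UnitAddCircle) : ℝ :=
  ∑ m ∈ Finset.range (n + 1), (arc m (k / 2 ^ (n - m))).indicator 1 t

theorem measurable_logFun (n k : ℕ) : Measurable (logFun n k) :=
  Finset.measurable_sum _ fun _ _ => measurable_one.indicator (measurableSet_arc _ _)

theorem logFun_of_mem {n k : ℕ} {t : UnitAddCircle} (h : t ∈ arc n k) : logFun n k t = n + 1 := by
  rw [logFun, Finset.sum_congr rfl fun m hm => Set.indicator_of_mem
    (arc_subset_of_le (Nat.lt_succ_iff.1 (Finset.mem_range.1 hm)) h) _]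
  simp

theorem abs_logFun_le (n k : ℕ) (t : UnitAddCircle) : |logFun n k t| ≤ n + 1 := by
  refine (Finset.abs_sum_le_sum_abs _ _).trans ?_
  refine (Finset.sum_le_card_nsmul _ _ 1 fun m _ => ?_).trans (by simp)
  by_cases h : t ∈ arc m (k / 2 ^ (n - m)) <;> simp [h]

/-- The number of dyadic arcs that contain both `arc a b` and `arc n k`. The function `logFun n k`
exceeds it on `arc a b` only through the arcs shorter than `arc a b`. -/
noncomputable def logConst (n k a b : ℕ) : ℝ :=
  ∑ m ∈ Finset.range (n + 1), if m ≤ a ∧ b / 2 ^ (a - m) = k / 2 ^ (n - m) then 1 else 0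

theorem logConst_zero {n k : ℕ} (hk : k < 2 ^ n) : logConst n k 0 0 = 1 := by
  rw [logConst, Finset.sum_eq_single_of_mem 0 (by simp)]
  · simp [Nat.div_eq_of_lt hk]
  · intro m _ hm
    simp [hm]

theorem sum_inv_two_pow_le (a n : ℕ) :
    ∑ m ∈ Finset.range n, (if a < m then ((2 : ℝ≥0∞) ^ m)⁻¹ else 0) ≤ (2 ^ a)⁻¹ := by
  have h : ∀ d, ∑ m ∈ Finset.range (a + 1 + d), (if a < m then ((2 : ℝ≥0∞) ^ m)⁻¹ else 0) +
      (2 ^ (a + d))⁻¹ = (2 ^ a)⁻¹ := by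
    intro d
    induction d with
    | zero =>
      rw [Finset.sum_eq_zero, zero_add, add_zero]
      intro m hm
      have := Finset.mem_range.1 hm
      rw [if_neg (by omega)]
    | succ d ih =>
      rw [← ih, ← add_assoc (a + 1), Finset.sum_range_succ, if_pos (by omega), add_assoc]
      congr 1
      have e1 : a + 1 + d = a + d + 1 := by omega
      rw [e1, ← add_assoc, ← two_mul, pow_succ, ENNReal.mul_inv (by simp) (by simp), mul_left_comm,
        ENNReal.mul_inv_cancel (by simp) (by simp), mul_one]
  calc _ ≤ ∑ m ∈ Finset.range (a + 1 + n), (if a < m then ((2 : ℝ≥0∞) ^ m)⁻¹ else 0) :=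
        Finset.sum_le_sum_of_subset (Finset.range_subset_range.2 (by omega))
    _ ≤ _ := by rw [← h n]; exact le_self_add

theorem lintegral_logFun_sub_le {n k a b : ℕ} (hk : k < 2 ^ n) (hb : b < 2 ^ a) :
    ∫⁻ t in arc a b, ‖logFun n k t - logConst n k a b‖ₑ ≤ volume (arc a b) := by
  have hpt : ∀ t ∈ arc a b, ‖logFun n k t - logConst n k a b‖ₑ ≤ ∑ m ∈ Finset.range (n + 1),
      if a < m then (arc m (k / 2 ^ (n - m))).indicator (1 : UnitAddCircle → ℝ≥0∞) t else 0 := by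
    intro t ht
    rw [logFun, logConst, ← Finset.sum_sub_distrib]
    refine (enorm_sum_le _ _).trans (Finset.sum_le_sum fun m _ => ?_)
    rw [mem_arc_iff] at ht
    split_ifs with h1 h2 h2
    · omega
    · have h3 : t ∈ arc m (k / 2 ^ (n - m)) := by
        rw [mem_arc_iff, arcIndex_of_le h1.1, ht, h1.2]
      simp [h3]
    · by_cases h3 : t ∈ arc m (k / 2 ^ (n - m)) <;> simp [h3]
    · have h3 : t ∉ arc m (k / 2 ^ (n - m)) := by
        rw [mem_arc_iff, arcIndex_of_le (not_lt.1 h2), ht]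
        exact fun h => h1 ⟨not_lt.1 h2, h⟩
      simp [h3]
  calc ∫⁻ t in arc a b, ‖logFun n k t - logConst n k a b‖ₑ
      ≤ ∫⁻ t in arc a b, ∑ m ∈ Finset.range (n + 1),
          if a < m then (arc m (k / 2 ^ (n - m))).indicator (1 : UnitAddCircle → ℝ≥0∞) t else 0 :=
        setLIntegral_mono_ae' (measurableSet_arc a b) (Filter.Eventually.of_forall hpt)
    _ ≤ ∫⁻ t, ∑ m ∈ Finset.range (n + 1),
          if a < m then (arc m (k / 2 ^ (n - m))).indicator (1 : UnitAddCircle → ℝ≥0∞) t else 0 :=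
        setLIntegral_le_lintegral _ _
    _ = ∑ m ∈ Finset.range (n + 1), (if a < m then ((2 : ℝ≥0∞) ^ m)⁻¹ else 0) := by
        rw [lintegral_finsetSum]
        · refine Finset.sum_congr rfl fun m hm => ?_
          split_ifs
          · rw [lintegral_indicator_one (measurableSet_arc _ _), volume_arc]
            have hmn : m ≤ n := Nat.lt_succ_iff.1 (Finset.mem_range.1 hm)
            rwa [Nat.div_lt_iff_lt_mul (by positivity), ← pow_add, Nat.add_sub_cancel' hmn]
          · simp
        · intro m _
          split_ifs
          · exact measurable_one.indicator (measurableSet_arc _ _)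
          · exact measurable_const
    _ ≤ _ := by
        rw [volume_arc hb]
        exact sum_inv_two_pow_le _ _

theorem memLp_logSum (𝕜 : Type*) [RCLike 𝕜] (R : Rect N) :
    MemLp (fun x : UnitAddTorus (Fin N) =>
      ((∑ i, logFun (R.1 i) (R.2 i) (x i) : ℝ) : 𝕜)) 2 volume := by
  have hm : Measurable fun x : UnitAddTorus (Fin N) => ∑ i, logFun (R.1 i) (R.2 i) (x i) :=
    Finset.measurable_sum _ fun i _ => (measurable_logFun _ _).comp (measurable_pi_apply i)
  refine MemLp.of_bound (RCLike.measurable_ofReal.comp hm).aestronglyMeasurable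
    (∑ i, ((R.1 i : ℝ) + 1)) (Filter.Eventually.of_forall fun x => ?_)
  rw [RCLike.norm_ofReal]
  exact (Finset.abs_sum_le_sum_abs _ _).trans
    (Finset.sum_le_sum fun i _ => abs_logFun_le _ _ _)

/-- The sum over the coordinates of the logarithmic functions of the sides of `R`. It takes its
maximal value on `R`, and its norm in little bmo is bounded independently of `R`. -/
noncomputable def logSum (𝕜 : Type*) [RCLike 𝕜] (R : Rect N) : L2 𝕜 N :=
  (memLp_logSum 𝕜 R).toLp _

theorem mean_logSum {R S : Rect N} (h : S.toSet ⊆ R.toSet) :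
    mean (logSum 𝕜 R) S = (((∑ i, R.1 i) + N : ℕ) : 𝕜) := by
  have hae : ∀ᵐ x ∂(volume.restrict S.toSet),
      logSum 𝕜 R x = (((∑ i, R.1 i) + N : ℕ) : 𝕜) := by
    filter_upwards [ae_restrict_of_ae (memLp_logSum 𝕜 R).coeFn_toLp,
      ae_restrict_mem S.measurableSet_toSet] with x hx hxS
    rw [logSum, hx, Finset.sum_congr rfl fun i _ => logFun_of_mem (h hxS i),
      Finset.sum_add_distrib]
    simp
  have hv : volume.real S.toSet ≠ 0 :=
    (measureReal_ne_zero_iff (measure_ne_top _ _)).2 S.volume_toSet_ne_zero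
  rw [mean, average_congr hae, setAverage_eq, setIntegral_const, smul_smul, inv_mul_cancel₀ hv,
    one_smul]

theorem lintegral_logSum_sub_le (R S : Rect N) :
    ∫⁻ x in S.toSet, ‖logSum 𝕜 R x -
      ((∑ i, logConst (R.1 i) (R.2 i) (S.1 i) (S.2 i) : ℝ) : 𝕜)‖ₑ ≤ N * volume S.toSet := by
  have hme : ∀ i, Measurable fun t : UnitAddCircle =>
      ‖logFun (R.1 i) (R.2 i) t - logConst (R.1 i) (R.2 i) (S.1 i) (S.2 i)‖ₑ :=
    fun i => ((measurable_logFun _ _).sub_const _).enorm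
  calc _ ≤ ∫⁻ x in S.toSet, ∑ i, ‖logFun (R.1 i) (R.2 i) (x i) -
          logConst (R.1 i) (R.2 i) (S.1 i) (S.2 i)‖ₑ := by
        refine lintegral_mono_ae ?_
        filter_upwards [ae_restrict_of_ae (memLp_logSum 𝕜 R).coeFn_toLp] with x hx
        rw [logSum, hx, ← RCLike.ofReal_sub, ← Finset.sum_sub_distrib]
        refine le_trans (le_of_eq ?_) (enorm_sum_le _ _)
        rw [← ofReal_norm, ← ofReal_norm, RCLike.norm_ofReal, Real.norm_eq_abs]
    _ = ∑ i, ∫⁻ x in S.toSet, ‖logFun (R.1 i) (R.2 i) (x i) -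
          logConst (R.1 i) (R.2 i) (S.1 i) (S.2 i)‖ₑ :=
        lintegral_finsetSum _ fun i _ => (hme i).comp (measurable_pi_apply i)
    _ ≤ ∑ i : Fin N, volume S.toSet := Finset.sum_le_sum fun i _ =>
        lintegral_rect_eval_le S i (hme i) (lintegral_logFun_sub_le (R.2 i).2 (S.2 i).2)
    _ = _ := by simp

theorem littleBmoNorm_logSum_le (R : Rect N) : littleBmoNorm (logSum 𝕜 R) ≤ 4 * N := by
  have h1 : littleBmoSeminorm (logSum 𝕜 R) ≤ 2 * N := by
    refine iSup_le fun S => (oscillation_le_two_mul _ S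
      ((∑ i, logConst (R.1 i) (R.2 i) (S.1 i) (S.2 i) : ℝ) : 𝕜)).trans ?_
    gcongr
    rw [ENNReal.inv_mul_le_iff S.volume_toSet_ne_zero (measure_ne_top _ _), mul_comm]
    exact lintegral_logSum_sub_le R S
  have h2 : ‖∫ x, logSum 𝕜 R x‖ₑ ≤ 2 * N := by
    have h3 := lintegral_logSum_sub_le (𝕜 := 𝕜) R (Rect.root N)
    have h4 : ∀ i, logConst (R.1 i) (R.2 i) ((Rect.root N).1 i) ((Rect.root N).2 i) = 1 := fun i =>
      logConst_zero (R.2 i).2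
    simp only [h4] at h3
    rw [Rect.toSet_root] at h3
    have h5 := (Measure.restrict_univ (μ := (volume : Measure (UnitAddTorus (Fin N)))))
    rw [h5, volume_univ_torus, mul_one] at h3
    calc _ ≤ ∫⁻ x, ‖logSum 𝕜 R x‖ₑ := enorm_integral_le_lintegral_enorm _
      _ ≤ ∫⁻ x, (‖logSum 𝕜 R x - ((∑ i : Fin N, (1 : ℝ) : ℝ) : 𝕜)‖ₑ + N) := by
          refine lintegral_mono fun x => ?_
          have hN : ‖((∑ i : Fin N, (1 : ℝ) : ℝ) : 𝕜)‖ₑ = N := by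
            rw [← ofReal_norm, RCLike.norm_ofReal]
            simp
          have := enorm_add_le (logSum 𝕜 R x - ((∑ i : Fin N, (1 : ℝ) : ℝ) : 𝕜))
            ((∑ i : Fin N, (1 : ℝ) : ℝ) : 𝕜)
          rwa [sub_add_cancel, hN] at this
      _ ≤ N + N := by
          rw [lintegral_add_right _ measurable_const, lintegral_const, volume_univ_torus, mul_one]
          gcongr
      _ = _ := (two_mul _).symm
  calc littleBmoNorm (logSum 𝕜 R) ≤ 2 * N + 2 * N := add_le_add h2 h1
    _ = _ := by ring

/-! ### Bounded paraproducts have symbols in LMO -/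

theorem coeff_paraproduct {φ f : L2 𝕜 N} (h : Summable (paraproductTerm φ f)) (R : Rect N) :
    coeff (paraproduct φ f) R = coeff φ R * mean f R :=
  coeff_tsum_smul_haar (a := fun R => coeff φ R * mean f R) h R

/-- Testing the paraproduct on `logSum 𝕜 R`. -/
theorem energy_le_of_subset_rect {φ : L2 𝕜 N} {C : ℝ≥0} (h : IsParaproductBound φ C) (R : Rect N)
    {E : Set (UnitAddTorus (Fin N))} (hE : E ⊆ R.toSet) :
    ((∑ i, R.1 i) + N : ℕ) ^ 2 * energy φ E ≤ (4 * N * C) ^ 2 * volume E := by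
  have hfin : littleBmoNorm (logSum 𝕜 R) < ∞ :=
    (littleBmoNorm_logSum_le R).trans_lt (by finiteness)
  obtain ⟨hs, -, hb⟩ := h (logSum 𝕜 R) (lt_of_le_of_lt le_add_self hfin)
  have hb' : productBMONorm (paraproduct φ (logSum 𝕜 R)) ≤ 4 * N * C :=
    hb.trans (by rw [mul_comm]; gcongr; exact littleBmoNorm_logSum_le R)
  have := (productBMONorm_le_iff (by finiteness)).1 hb' E
  refine le_trans (le_of_eq ?_) this
  rw [energy, energy, ← ENNReal.tsum_mul_left]
  refine tsum_congr fun S => ?_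
  rw [coeff_paraproduct hs, mean_logSum (S.2.trans hE), enorm_mul, mul_pow, mul_comm]
  congr 2
  rw [← ofReal_norm, RCLike.norm_natCast, ENNReal.ofReal_natCast]

/-- Each rectangle of generation at least `j` lies in one rectangle of generation `j`. -/
theorem energy_tailProj_le_sum (φ : L2 𝕜 N) (j : Fin N → ℕ) (E : Set (UnitAddTorus (Fin N))) :
    energy (tailProj j φ) E ≤ ∑ p : Pos j, energy φ (E ∩ Rect.toSet ⟨j, p⟩) := by
  classical
  simp only [energy_eq_tsum_indicator]
  rw [← Summable.tsum_finsetSum fun _ _ => ENNReal.summable]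
  refine ENNReal.tsum_le_tsum fun S => ?_
  by_cases hS : S.toSet ⊆ E
  · by_cases hj : j ≤ S.1
    · refine le_trans ?_ (Finset.single_le_sum (fun _ _ => zero_le)
        (Finset.mem_univ (S.ancestor j hj).2))
      rw [Set.indicator_of_mem (by exact hS), Set.indicator_of_mem, coeff_tailProj, if_pos hj]
      exact Set.subset_inter hS (S.toSet_subset_ancestor j hj)
    · rw [Set.indicator_of_mem (by exact hS), coeff_tailProj, if_neg hj]
      simp
  · rw [Set.indicator_of_notMem (by exact hS)]
    exact zero_le

theorem sum_volume_inter_le (j : Fin N → ℕ) (E : Set (UnitAddTorus (Fin N))) :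
    ∑ p : Pos j, volume (E ∩ Rect.toSet ⟨j, p⟩) ≤ volume E := by
  have h : ∀ p : Pos j, volume (E ∩ Rect.toSet ⟨j, p⟩) =
      volume.restrict E (Rect.toSet ⟨j, p⟩) := fun p => by
    rw [Measure.restrict_apply (Rect.measurableSet_toSet _), Set.inter_comm]
  rw [Finset.sum_congr rfl fun p _ => h p, ← tsum_fintype (L := .unconditional _),
    ← measure_iUnion (Rect.pairwise_disjoint j) fun p => Rect.measurableSet_toSet _]
  exact (measure_mono (Set.subset_univ _)).trans (by rw [Measure.restrict_apply_univ])

theorem IsParaproductBound.isLMOBound (hN : 1 ≤ N) {φ : L2 𝕜 N} {C : ℝ≥0}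
    (h : IsParaproductBound φ C) : IsLMOBound φ (4 * N * C) := by
  intro j
  have hn : (∑ i, (j i : ℝ≥0∞)) + (N : ℝ≥0∞) = ((∑ i, j i) + N : ℕ) := by push_cast; rfl
  rw [hn]
  set n := (∑ i, j i) + N with hndef
  have hn0 : (n : ℝ≥0∞) ≠ 0 := by
    rw [Nat.cast_ne_zero]; omega
  have hn2 : (n : ℝ≥0∞) ^ 2 ≠ 0 := pow_ne_zero _ hn0
  rw [productBMONorm_le_iff (ENNReal.div_ne_top ENNReal.coe_ne_top hn0)]
  intro E
  have hp : ∀ p : Pos j, energy φ (E ∩ Rect.toSet ⟨j, p⟩) ≤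
      (((4 * N * C : ℝ≥0) : ℝ≥0∞) / n) ^ 2 * volume (E ∩ Rect.toSet ⟨j, p⟩) := by
    intro p
    have h1 := energy_le_of_subset_rect h ⟨j, p⟩ (E := E ∩ Rect.toSet ⟨j, p⟩)
      Set.inter_subset_right
    rw [ENNReal.div_eq_inv_mul, mul_pow, mul_assoc, ← ENNReal.inv_pow, ← ENNReal.div_eq_inv_mul,
      ENNReal.le_div_iff_mul_le (Or.inl hn2) (Or.inl (by finiteness))]
    refine le_trans (le_of_eq ?_) (h1.trans (le_of_eq ?_))
    · rw [mul_comm]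
    · push_cast
      rfl
  calc energy (tailProj j φ) E ≤ ∑ p : Pos j, energy φ (E ∩ Rect.toSet ⟨j, p⟩) :=
        energy_tailProj_le_sum φ j E
    _ ≤ ∑ p : Pos j, (((4 * N * C : ℝ≥0) : ℝ≥0∞) / n) ^ 2 * volume (E ∩ Rect.toSet ⟨j, p⟩) :=
        Finset.sum_le_sum fun p _ => hp p
    _ ≤ _ := by
        rw [← Finset.mul_sum]
        gcongr
        exact sum_volume_inter_le j E

/-! ### Growth and distribution of the means of functions in little bmo -/

theorem enorm_mean_sub_mean_ancestor_le (f : L2 𝕜 N) (R : Rect N) (i : Fin N) (n : ℕ)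
    (h : R.1 i = n + 1) (h' : Function.update R.1 i n ≤ R.1) :
    ‖mean f R - mean f (R.ancestor _ h')‖ₑ ≤ 2 * littleBmoSeminorm f := by
  set P := R.ancestor _ h'
  have hv : (volume R.toSet)⁻¹ = 2 * (volume P.toSet)⁻¹ := by
    rw [Rect.volume_ancestor_update R i n h h', ENNReal.mul_inv (by simp) (by simp), ← mul_assoc,
      ENNReal.mul_inv_cancel (by simp) (by simp), one_mul]
  calc ‖mean f R - mean f P‖ₑ
      ≤ (volume R.toSet)⁻¹ * ∫⁻ x in R.toSet, ‖f x - mean f P‖ₑ := enorm_mean_sub_le f R _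
    _ ≤ 2 * ((volume P.toSet)⁻¹ * ∫⁻ x in P.toSet, ‖f x - mean f P‖ₑ) := by
        rw [hv, mul_assoc]
        gcongr
        exact R.toSet_subset_ancestor _ _
    _ ≤ _ := by
        gcongr
        exact le_iSup (fun R : Rect N => (volume R.toSet)⁻¹ * ∫⁻ x in R.toSet, ‖f x - mean f R‖ₑ) P

/-- The means of a function in little bmo grow at most linearly in the generation, by telescoping
along a chain of rectangles that are halved in one coordinate at a time. -/
theorem enorm_mean_le (f : L2 𝕜 N) (R : Rect N) :
    ‖mean f R‖ₑ ≤ ‖∫ x, f x‖ₑ + 2 * (∑ i, R.1 i : ℕ) * littleBmoSeminorm f := by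
  induction hs : ∑ i, R.1 i generalizing R with
  | zero =>
    have h0 : ∀ i, R.1 i = 0 := fun i => by
      have := Finset.sum_eq_zero_iff.1 hs i (Finset.mem_univ i)
      exact this
    have hu : R.toSet = Set.univ := by
      ext x
      simp only [Rect.mem_toSet_iff, Set.mem_univ, iff_true]
      intro i
      have h1 := arcIndex_lt (R.1 i) (x i)
      have h2 := (R.2 i).2
      have h3 : 2 ^ R.1 i = 1 := by rw [h0 i, pow_zero]
      omega
    have : mean f R = ∫ x, f x := by
      rw [mean, hu, setAverage_eq, measureReal_def, volume_univ_torus]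
      simp
    rw [this]
    simp
  | succ m ih =>
    have hex : ∃ i, R.1 i ≠ 0 := by
      by_contra! hc
      simp [hc] at hs
    obtain ⟨i, hi⟩ := hex
    obtain ⟨n, hn⟩ := Nat.exists_eq_succ_of_ne_zero hi
    have h' : Function.update R.1 i n ≤ R.1 := by
      rw [update_le_self_iff]
      omega
    have hsum : ∑ k, (R.ancestor _ h').1 k = m := by
      change ∑ k, Function.update R.1 i n k = m
      rw [Finset.sum_update_of_mem (Finset.mem_univ i)]
      rw [Finset.sum_eq_add_sum_sdiff_singleton_of_mem (Finset.mem_univ i)] at hs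
      omega
    have h1 := ih (R.ancestor _ h') hsum
    calc ‖mean f R‖ₑ = ‖mean f (R.ancestor _ h') + (mean f R - mean f (R.ancestor _ h'))‖ₑ := by
          rw [add_sub_cancel]
      _ ≤ ‖mean f (R.ancestor _ h')‖ₑ + ‖mean f R - mean f (R.ancestor _ h')‖ₑ := enorm_add_le _ _
      _ ≤ (‖∫ x, f x‖ₑ + 2 * m * littleBmoSeminorm f) + 2 * littleBmoSeminorm f :=
          add_le_add h1 (enorm_mean_sub_mean_ancestor_le f R i n hn h')
      _ = _ := by push_cast; ring

/-- The relative size `‖m_R f‖ / K + 1` of the mean on `R` of a function of norm at most `K`. -/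
noncomputable def relMean (f : L2 𝕜 N) (K : ℝ≥0) (R : Rect N) : ℝ := ‖mean f R‖ / K + 1

theorem one_le_relMean (f : L2 𝕜 N) (K : ℝ≥0) (R : Rect N) : 1 ≤ relMean f K R :=
  le_add_of_nonneg_left (by positivity)

theorem relMean_le (hN : 1 ≤ N) {f : L2 𝕜 N} {K : ℝ≥0} (hK : 0 < K) (h : littleBmoNorm f ≤ K)
    (R : Rect N) : relMean f K R ≤ 2 * (∑ i, (R.1 i + 1) : ℕ) := by
  have h1 : ‖∫ x, f x‖ₑ ≤ K := le_self_add.trans h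
  have h2 : littleBmoSeminorm f ≤ K := le_add_self.trans h
  have h3 : ‖mean f R‖ₑ ≤ ((K + 2 * (∑ i, R.1 i : ℕ) * K : ℝ≥0) : ℝ≥0∞) := by
    refine (enorm_mean_le f R).trans ?_
    push_cast
    gcongr
  have h4 : ‖mean f R‖ ≤ K + 2 * (∑ i, R.1 i : ℕ) * K := by
    have : ‖mean f R‖₊ ≤ K + 2 * (∑ i, R.1 i : ℕ) * K := by
      rwa [enorm_eq_nnnorm, ENNReal.coe_le_coe] at h3
    exact_mod_cast this
  have hK' : (0 : ℝ) < K := hK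
  have h5 : ‖mean f R‖ / K ≤ 1 + 2 * (∑ i, R.1 i : ℕ) := by
    rw [div_le_iff₀ hK']
    linarith
  have hN' : (1 : ℝ) ≤ N := by exact_mod_cast hN
  rw [relMean, Finset.sum_add_distrib]
  push_cast at h5 ⊢
  simp only [Finset.sum_const, Finset.card_univ, Fintype.card_fin, nsmul_eq_mul, mul_one]
  linarith

/-- The part of `E` on which `‖f‖ / K + 1` is comparable to `2 ^ l`. -/
def levelSet (f : L2 𝕜 N) (K : ℝ≥0) (E : Set (UnitAddTorus (Fin N))) (l : ℕ) :
    Set (UnitAddTorus (Fin N)) :=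
  E ∩ {x | (2 : ℝ) ^ l ≤ 3 * (‖f x‖ / K + 1) ∧ ‖f x‖ / K + 1 ≤ 6 * 2 ^ l}

theorem measurableSet_levelSet (f : L2 𝕜 N) (K : ℝ≥0) {E : Set (UnitAddTorus (Fin N))}
    (hE : MeasurableSet E) (l : ℕ) : MeasurableSet (levelSet f K E l) := by
  have hf : Measurable fun x => ‖f x‖ / K + 1 :=
    ((Lp.stronglyMeasurable f).measurable.norm.div_const _).add_const _
  exact hE.inter ((measurableSet_le measurable_const (hf.const_mul _)).inter
    (measurableSet_le hf measurable_const))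

/-- By Chebyshev's inequality `‖f‖ / K + 1` is comparable to `relMean f K R` on at least one half
of the rectangle `R`. -/
theorem half_le_volume_inter_levelSet {f : L2 𝕜 N} {K : ℝ≥0} (hK : 0 < K)
    (h : littleBmoNorm f ≤ K) {E : Set (UnitAddTorus (Fin N))} {R : Rect N} (hR : R.toSet ⊆ E)
    {l : ℕ} (hl : 2 ^ l ≤ relMean f K R) (hl' : relMean f K R < 2 ^ (l + 1)) :
    (2⁻¹ : ℝ≥0) * volume R.toSet ≤ volume (R.toSet ∩ levelSet f K E l) := by
  have hK' : (0 : ℝ) < K := hK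
  set T := {x | (2 * K : ℝ≥0∞) ≤ ‖f x - mean f R‖ₑ} with hT
  have h2 : littleBmoSeminorm f ≤ K := le_add_self.trans h
  have h3 : ∫⁻ x in R.toSet, ‖f x - mean f R‖ₑ ≤ K * volume R.toSet := by
    have := (le_iSup (fun R : Rect N => (volume R.toSet)⁻¹ *
      ∫⁻ x in R.toSet, ‖f x - mean f R‖ₑ) R).trans h2
    rwa [ENNReal.inv_mul_le_iff R.volume_toSet_ne_zero (measure_ne_top _ _), mul_comm] at this
  have hme : Measurable fun x => ‖f x - mean f R‖ₑ :=
    ((Lp.stronglyMeasurable f).measurable.sub_const _).enorm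
  have h4 : 2 * volume (R.toSet ∩ T) ≤ volume R.toSet := by
    have h5 := (mul_meas_ge_le_lintegral (μ := volume.restrict R.toSet) hme (2 * K)).trans h3
    rw [Measure.restrict_apply (measurableSet_le measurable_const hme), Set.inter_comm,
      ← hT, mul_comm 2 (K : ℝ≥0∞), mul_assoc] at h5
    exact (ENNReal.mul_le_mul_iff_right (by simpa using hK.ne') ENNReal.coe_ne_top).1 h5
  have hsub : R.toSet ⊆ (R.toSet ∩ levelSet f K E l) ∪ (R.toSet ∩ T) := by
    intro x hx
    by_cases hxT : x ∈ T
    · exact Or.inr ⟨hx, hxT⟩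
    · refine Or.inl ⟨hx, hR hx, ?_⟩
      have h6 : ‖f x - mean f R‖ < 2 * K := by
        have : ‖f x - mean f R‖ₑ < ((2 * K : ℝ≥0) : ℝ≥0∞) := by
          push_cast; exact not_le.1 hxT
        rw [enorm_eq_nnnorm, ENNReal.coe_lt_coe] at this
        exact_mod_cast this
      have h7 := norm_sub_norm_le (f x) (mean f R)
      have h8 := norm_sub_norm_le (mean f R) (f x)
      rw [norm_sub_rev] at h8
      have h9 : ‖f x‖ / K ≤ ‖mean f R‖ / K + 2 := by
        rw [div_add' _ _ _ hK'.ne']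
        gcongr
        linarith
      have h10 : ‖mean f R‖ / K ≤ ‖f x‖ / K + 2 := by
        rw [div_add' _ _ _ hK'.ne']
        gcongr
        linarith
      have h11 : 0 ≤ ‖f x‖ / K := by positivity
      have h12 := one_le_relMean f K R
      rw [pow_succ] at hl'
      rw [relMean] at hl hl' h12
      constructor <;> linarith
  have h13 := (measure_mono hsub).trans (measure_union_le (μ := volume) _ _)
  have h14 : volume R.toSet ≤ 2 * volume (R.toSet ∩ levelSet f K E l) := by
    have h15 : volume R.toSet + volume R.toSet ≤
        2 * volume (R.toSet ∩ levelSet f K E l) + volume R.toSet := by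
      calc volume R.toSet + volume R.toSet = 2 * volume R.toSet := (two_mul _).symm
        _ ≤ 2 * (volume (R.toSet ∩ levelSet f K E l) + volume (R.toSet ∩ T)) := by gcongr
        _ = 2 * volume (R.toSet ∩ levelSet f K E l) + 2 * volume (R.toSet ∩ T) := mul_add _ _ _
        _ ≤ _ := by gcongr
    exact (ENNReal.add_le_add_iff_right (measure_ne_top _ _)).1 h15
  rw [ENNReal.coe_inv (by norm_num), ENNReal.coe_ofNat,
    ENNReal.inv_mul_le_iff (by norm_num) (by norm_num)]
  exact h14

/-- The level sets overlap boundedly: `2 ^ l` lies in an interval `[s, 18 s]`, which holds for at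
most five values of `l`. -/
theorem tsum_volume_levelSet_le (f : L2 𝕜 N) (K : ℝ≥0) {E : Set (UnitAddTorus (Fin N))}
    (hE : MeasurableSet E) : ∑' l, volume (levelSet f K E l) ≤ 5 * volume E := by
  have hpt : ∀ x, ∑' l, (levelSet f K E l).indicator (1 : UnitAddTorus (Fin N) → ℝ≥0∞) x ≤
      E.indicator (fun _ => 5) x := by
    intro x
    by_cases hx : ∃ l, x ∈ levelSet f K E l
    · classical
      set a := Nat.find hx with ha
      have hmem : x ∈ levelSet f K E a := Nat.find_spec hx
      have hsupp : ∀ l ∉ Finset.Ico a (a + 5),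
          (levelSet f K E l).indicator (1 : UnitAddTorus (Fin N) → ℝ≥0∞) x = 0 := by
        intro l hl
        refine Set.indicator_of_notMem (fun hxl => hl ?_) _
        have h1 : a ≤ l := Nat.find_min' hx hxl
        refine Finset.mem_Ico.2 ⟨h1, ?_⟩
        by_contra hlt
        have h2 : (2 : ℝ) ^ (a + 5) ≤ 2 ^ l := pow_le_pow_right₀ (by norm_num) (by omega)
        have h3 := hxl.2.1
        have h4 := hmem.2.2
        have h5 : (0 : ℝ) < 2 ^ a := by positivity
        rw [pow_add] at h2
        linarith
      rw [tsum_eq_sum hsupp, Set.indicator_of_mem hmem.1]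
      refine (Finset.sum_le_card_nsmul _ _ 1 fun l _ => ?_).trans (by simp)
      exact Set.indicator_le_self' (fun _ _ => zero_le) x
    · push Not at hx
      rw [tsum_congr fun l => Set.indicator_of_notMem (hx l) _]
      simp
  calc ∑' l, volume (levelSet f K E l)
      = ∑' l, ∫⁻ x, (levelSet f K E l).indicator 1 x := by
        refine tsum_congr fun l => ?_
        rw [lintegral_indicator_one (measurableSet_levelSet f K hE l)]
    _ = ∫⁻ x, ∑' l, (levelSet f K E l).indicator 1 x :=
        (lintegral_tsum fun l =>
          (measurable_one.indicator (measurableSet_levelSet f K hE l)).aemeasurable).symm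
    _ ≤ ∫⁻ x, E.indicator (fun _ => 5) x := lintegral_mono hpt
    _ = _ := by rw [lintegral_indicator hE, lintegral_const, Measure.restrict_apply_univ]

/-! ### Symbols in LMO have bounded paraproducts -/

/-- Rectangles whose total generation is at least of order `2 ^ l` have one long coordinate
generation, so that they are seen by a tail projection in that single coordinate. -/
theorem IsLMOBound.energy_le (hN : 1 ≤ N) {φ : L2 𝕜 N} {C : ℝ≥0} (h : IsLMOBound φ C) (l : ℕ)
    (U : Set (UnitAddTorus (Fin N))) (S : Set (Rect N)) (hS : ∀ R ∈ S, R.toSet ⊆ U)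
    (hS' : ∀ R ∈ S, 2 ^ l ≤ 2 * ∑ i, (R.1 i + 1)) :
    (2 ^ l) ^ 2 * ∑' R, S.indicator (fun R => ‖coeff φ R‖ₑ ^ 2) R ≤
      N * (4 * N * C) ^ 2 * volume U := by
  classical
  -- `2 ^ l ≤ 2 N (R.1 i + 1)` for some `i`, which gives `n ≤ R.1 i`
  set n := 2 ^ l / (2 * N) - 1 with hn
  have hn1 : 2 ^ l ≤ 4 * N * (n + N) := by
    have h1 : 2 ^ l < 2 * N * (2 ^ l / (2 * N) + 1) := Nat.lt_mul_div_succ _ (by omega)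
    have h2 : 2 ^ l / (2 * N) + 1 ≤ 2 * (n + N) := by omega
    calc 2 ^ l ≤ 2 * N * (2 ^ l / (2 * N) + 1) := h1.le
      _ ≤ 2 * N * (2 * (n + N)) := by gcongr
      _ = _ := by ring
  have hcoord : ∀ R ∈ S, ∃ i, n ≤ R.1 i := by
    intro R hR
    by_contra! hc
    have h1 : ∀ i ∈ Finset.univ, R.1 i + 1 ≤ n := fun i _ => hc i
    have h2 := Finset.sum_le_card_nsmul _ _ n h1
    simp only [Finset.card_univ, Fintype.card_fin, smul_eq_mul] at h2
    have h3 := hS' R hR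
    have h4 : 2 ^ l ≤ 2 * N * n := by
      rw [mul_assoc]
      exact h3.trans (by gcongr)
    have h5 : 2 ^ l / (2 * N) ≤ n := Nat.div_le_of_le_mul h4
    have h6 : 1 ≤ n := by
      have := hc ⟨0, hN⟩
      omega
    omega
  have htail : ∀ i, (2 ^ l) ^ 2 * energy (tailProj (Pi.single i n) φ) U ≤
      (4 * N * C) ^ 2 * volume U := by
    intro i
    have h1 := h (Pi.single i n)
    have h2 : (∑ k, ((Pi.single i n : Fin N → ℕ) k : ℝ≥0∞)) + (N : ℝ≥0∞) = (n + N : ℕ) := by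
      rw [← Nat.cast_sum, Finset.sum_pi_single']
      simp
    rw [h2] at h1
    have h0 : ((n + N : ℕ) : ℝ≥0∞) ≠ 0 := by rw [Nat.cast_ne_zero]; omega
    rw [productBMONorm_le_iff (ENNReal.div_ne_top ENNReal.coe_ne_top h0)] at h1
    have h3 : (2 : ℝ≥0∞) ^ l ≤ 4 * N * (n + N : ℕ) := by exact_mod_cast hn1
    calc (2 ^ l) ^ 2 * energy (tailProj (Pi.single i n) φ) U
        ≤ (4 * N * (n + N : ℕ)) ^ 2 * ((C / (n + N : ℕ)) ^ 2 * volume U) := by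
          gcongr
          exact h1 U
      _ = (4 * N * ((n + N : ℕ) * (C / (n + N : ℕ)))) ^ 2 * volume U := by ring
      _ = _ := by rw [ENNReal.mul_div_cancel h0 (by finiteness)]
  have hsum : ∑' R, S.indicator (fun R => ‖coeff φ R‖ₑ ^ 2) R ≤
      ∑ i, energy (tailProj (Pi.single i n) φ) U := by
    simp only [energy_eq_tsum_indicator]
    rw [← Summable.tsum_finsetSum fun _ _ => ENNReal.summable]
    refine ENNReal.tsum_le_tsum fun R => ?_
    by_cases hR : R ∈ S
    · obtain ⟨i, hi⟩ := hcoord R hR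
      refine le_trans ?_ (Finset.single_le_sum (fun _ _ => zero_le) (Finset.mem_univ i))
      have hle : Pi.single i n ≤ R.1 := by
        intro k
        rcases eq_or_ne k i with rfl | hk
        · simpa using hi
        · simp [hk]
      rw [Set.indicator_of_mem hR, Set.indicator_of_mem (by exact hS R hR), coeff_tailProj,
        if_pos hle]
    · rw [Set.indicator_of_notMem hR]
      exact zero_le
  calc (2 ^ l) ^ 2 * ∑' R, S.indicator (fun R => ‖coeff φ R‖ₑ ^ 2) R
      ≤ ∑ i, (2 ^ l) ^ 2 * energy (tailProj (Pi.single i n) φ) U := by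
        rw [← Finset.mul_sum]; gcongr
    _ ≤ ∑ i : Fin N, (4 * N * C) ^ 2 * volume U := Finset.sum_le_sum fun i _ => htail i
    _ = _ := by simp [mul_assoc]

/-- The Carleson type estimate for the coefficients of the paraproduct. The rectangles in `E` are
sorted by the size `2 ^ l` of the mean of `f`. The ones at level `l` lie in the halo of the level
set of `f`, and the logarithmic decay of the tails of `φ` compensates the size of the mean. -/
theorem exists_tsum_coeff_mul_mean_le (hN : 1 ≤ N) : ∃ D : ℝ≥0, 0 < D ∧
    ∀ (𝕜 : Type*) [RCLike 𝕜] (φ f : L2 𝕜 N) (C K : ℝ≥0), IsLMOBound φ C → 0 < K →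
      littleBmoNorm f ≤ K → ∀ E, MeasurableSet E →
        ∑' R, {R : Rect N | R.toSet ⊆ E}.indicator (fun R => ‖coeff φ R * mean f R‖ₑ ^ 2) R ≤
          (D * C * K) ^ 2 * volume E := by
  obtain ⟨A, hA⟩ := haloBound_rect N 2⁻¹ (by norm_num)
  set D₀ : ℝ≥0 := 4 * N * (4 * N) ^ 2 * A * 5 with hD₀
  -- the square of `D₀ + 1` dominates `D₀`
  refine ⟨D₀ + 1, by positivity, ?_⟩
  intro 𝕜 _ φ f C K hφ hK hf E hE
  have hK' : (0 : ℝ) < K := hK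
  have hlev : ∀ R : Rect N, ∃ l : ℕ, 2 ^ l ≤ relMean f K R ∧ relMean f K R < 2 ^ (l + 1) :=
    fun R => exists_nat_pow_near (one_le_relMean f K R) one_lt_two
  choose lev hlev1 hlev2 using hlev
  set S : ℕ → Set (Rect N) := fun l => {R | R.toSet ⊆ E ∧ lev R = l} with hSdef
  set U : ℕ → Set (UnitAddTorus (Fin N)) :=
    fun l => halo volume (fun R : Rect N => R.toSet) 2⁻¹ (levelSet f K E l) with hU
  have hterm : ∀ R : Rect N, {R : Rect N | R.toSet ⊆ E}.indicator
      (fun R => ‖coeff φ R * mean f R‖ₑ ^ 2) R ≤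
      ∑' l, 4 * K ^ 2 * ((2 ^ l) ^ 2 * (S l).indicator (fun R => ‖coeff φ R‖ₑ ^ 2) R) := by
    intro R
    by_cases hR : R.toSet ⊆ E
    · refine le_trans ?_ (ENNReal.le_tsum (lev R))
      rw [Set.indicator_of_mem (by exact hR), Set.indicator_of_mem (by exact ⟨hR, rfl⟩)]
      have h1 : ‖mean f R‖ₑ ≤ 2 * K * 2 ^ lev R := by
        have h2 := hlev2 R
        have h3 : ‖mean f R‖ / K ≤ 2 ^ (lev R + 1) := by rw [relMean] at h2; linarith
        rw [div_le_iff₀ hK'] at h3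
        have h4 : ‖mean f R‖₊ ≤ 2 ^ (lev R + 1) * K := by exact_mod_cast h3
        calc ‖mean f R‖ₑ ≤ ((2 ^ (lev R + 1) * K : ℝ≥0) : ℝ≥0∞) := by
              rw [enorm_eq_nnnorm]; exact_mod_cast h4
          _ = _ := by push_cast; ring
      calc ‖coeff φ R * mean f R‖ₑ ^ 2 = ‖coeff φ R‖ₑ ^ 2 * ‖mean f R‖ₑ ^ 2 := by
            rw [enorm_mul, mul_pow]
        _ ≤ ‖coeff φ R‖ₑ ^ 2 * (2 * K * 2 ^ lev R) ^ 2 := by gcongr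
        _ = _ := by ring
    · rw [Set.indicator_of_notMem (by exact hR)]
      exact zero_le
  have hlevel : ∀ l, (2 ^ l) ^ 2 * ∑' R, (S l).indicator (fun R => ‖coeff φ R‖ₑ ^ 2) R ≤
      N * (4 * N * C) ^ 2 * volume (U l) := by
    intro l
    refine hφ.energy_le hN l (U l) (S l) ?_ ?_
    · rintro R ⟨hR, rfl⟩ x hx
      exact mem_halo.2 ⟨R, half_le_volume_inter_levelSet hK hf hR (hlev1 R) (hlev2 R), hx⟩
    · rintro R ⟨hR, rfl⟩
      have := (hlev1 R).trans (relMean_le hN hK hf R)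
      exact_mod_cast this
  calc _ ≤ ∑' R, ∑' l, 4 * K ^ 2 * ((2 ^ l) ^ 2 * (S l).indicator (fun R => ‖coeff φ R‖ₑ ^ 2) R) :=
        ENNReal.tsum_le_tsum hterm
    _ = ∑' l, 4 * K ^ 2 * ((2 ^ l) ^ 2 * ∑' R, (S l).indicator (fun R => ‖coeff φ R‖ₑ ^ 2) R) := by
        rw [ENNReal.tsum_comm]
        simp only [ENNReal.tsum_mul_left]
    _ ≤ ∑' l, 4 * K ^ 2 * (N * (4 * N * C) ^ 2 * (A * volume (levelSet f K E l))) := by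
        refine ENNReal.tsum_le_tsum fun l => mul_le_mul_right ((hlevel l).trans ?_) _
        gcongr
        exact hA _ (measurableSet_levelSet f K hE l)
    _ ≤ 4 * K ^ 2 * (N * (4 * N * C) ^ 2 * (A * (5 * volume E))) := by
        simp only [ENNReal.tsum_mul_left]
        gcongr
        exact tsum_volume_levelSet_le f K hE
    _ = (D₀ : ℝ≥0∞) * (C * K) ^ 2 * volume E := by
        rw [hD₀]; push_cast; ring
    _ ≤ ((D₀ + 1 : ℝ≥0) : ℝ≥0∞) ^ 2 * (C * K) ^ 2 * volume E := by
        gcongr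
        rw [← ENNReal.coe_pow, ENNReal.coe_le_coe]
        nlinarith [zero_le (a := D₀)]
    _ = _ := by ring

theorem exists_isParaproductBound (hN : 1 ≤ N) : ∃ D : ℝ≥0, 0 < D ∧
    ∀ (𝕜 : Type*) [RCLike 𝕜] (φ : L2 𝕜 N) (C : ℝ≥0), IsLMOBound φ C →
      IsParaproductBound φ (D * C) := by
  obtain ⟨D, hD0, hD⟩ := exists_tsum_coeff_mul_mean_le hN
  refine ⟨D, hD0, fun 𝕜 _ φ C hφ f hf => ?_⟩
  have hfin : littleBmoNorm f < ∞ := ENNReal.add_lt_top.2 ⟨enorm_lt_top, hf⟩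
  have hsum : Summable (paraproductTerm φ f) := by
    refine summable_smul_haar_iff.2 ?_
    have hle : littleBmoNorm f ≤ ((littleBmoNorm f).toNNReal + 1 : ℝ≥0) := by
      push_cast
      rw [ENNReal.coe_toNNReal hfin.ne]
      exact le_self_add
    have h1 := hD 𝕜 φ f C _ hφ (by positivity) hle Set.univ MeasurableSet.univ
    simp only [Set.subset_univ, Set.ofPred_true, Set.indicator_univ, volume_univ_torus] at h1
    have h2 := ENNReal.summable_toReal (ne_top_of_le_ne_top (by finiteness) h1)
    simpa using h2
  have hnorm : ∀ K : ℝ≥0, 0 < K → littleBmoNorm f ≤ K →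
      productBMONorm (paraproduct φ f) ≤ (D * C : ℝ≥0) * K := by
    intro K hK hfK
    rw [productBMONorm_le_iff (by finiteness)]
    intro E
    calc energy (paraproduct φ f) E ≤ energy (paraproduct φ f) (toMeasurable volume E) :=
          energy_mono _ (subset_toMeasurable _ _)
      _ ≤ (D * C * K) ^ 2 * volume (toMeasurable volume E) := by
          rw [energy_eq_tsum_indicator]
          simp only [coeff_paraproduct hsum]
          exact hD 𝕜 φ f C K hφ hK hfK _ (measurableSet_toMeasurable _ _)
      _ = _ := by rw [measure_toMeasurable, ENNReal.coe_mul]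
  -- the bound for all `K > 0` with `‖f‖ ≤ K` covers the case `‖f‖ = 0` as well
  have hle : productBMONorm (paraproduct φ f) ≤ (D * C : ℝ≥0) * littleBmoNorm f := by
    refine ENNReal.le_mul_of_forall_lt (Or.inr hfin.ne) (Or.inl ENNReal.coe_ne_top) ?_
    intro a ha b hb
    rcases eq_or_ne b ∞ with rfl | hb'
    · rw [ENNReal.mul_top (ne_bot_of_gt ha)]
      exact le_top
    · lift b to ℝ≥0 using hb'
      exact (hnorm b (by exact_mod_cast pos_of_gt hb) hb.le).trans (by gcongr)
  refine ⟨hsum, ⟨?_, hle.trans_lt (by finiteness)⟩, hle⟩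
  unfold MemL20
  simp only [coeff_paraproduct hsum]
  exact hsum.hasSum

end DyadicTorus

theorem theorem2p4 (𝕜 : Type*) [RCLike 𝕜] (N : ℕ) (hN : 1 ≤ N) :
    (∀ φ : DyadicTorus.L2 𝕜 N, DyadicTorus.MemLMO φ ↔ DyadicTorus.ParaproductBounded φ) ∧
    ∃ c C : ℝ≥0, 0 < c ∧ 0 < C ∧ ∀ φ : DyadicTorus.L2 𝕜 N,
      (c : ℝ≥0∞) * DyadicTorus.lmoNorm φ ≤ DyadicTorus.paraproductNorm φ ∧
      DyadicTorus.paraproductNorm φ ≤ (C : ℝ≥0∞) * DyadicTorus.lmoNorm φ := by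
  obtain ⟨D, hD0, hD⟩ := DyadicTorus.exists_isParaproductBound hN
  have hN' : (N : ℝ≥0) ≠ 0 := by rw [Nat.cast_ne_zero]; omega
  have h4N : (4 * N : ℝ≥0) ≠ 0 := mul_ne_zero (by norm_num) hN'
  refine ⟨fun φ => ⟨fun ⟨C, hC⟩ => ⟨_, hD 𝕜 φ C hC⟩, fun ⟨C, hC⟩ => ⟨_, hC.isLMOBound hN⟩⟩,
    (4 * N)⁻¹, D, by positivity, hD0, fun φ => ⟨?_, ?_⟩⟩
  · refine le_iInf₂ fun C hC => ?_
    have h1 : DyadicTorus.lmoNorm φ ≤ ((4 * N * C : ℝ≥0) : ℝ≥0∞) :=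
      iInf₂_le _ (hC.isLMOBound hN)
    rw [ENNReal.coe_inv h4N, ENNReal.inv_mul_le_iff (by exact_mod_cast h4N) ENNReal.coe_ne_top,
      ← ENNReal.coe_mul]
    exact h1
  · rw [DyadicTorus.lmoNorm]
    simp only [ENNReal.mul_iInf_of_ne (ENNReal.coe_ne_zero.2 hD0.ne') ENNReal.coe_ne_top]
    refine le_iInf₂ fun C hC => ?_
    rw [← ENNReal.coe_mul]
    exact iInf₂_le _ (hD 𝕜 φ C hC)
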